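/- **Setting.** Let $V,H$ be real separable Hilbert spaces with $V\hookrightarrow H$ continuously, densely and compactly, $\langle\cdot,\cdot\rangle$ and $\|\cdot\|$ the scalar product and norm of $H$, and $V\hookrightarrow H\simeq H'\hookrightarrow V'$ the resulting Gelfand triple; $\langle\cdot,\cdot\rangle$ also denotes the duality pairing on $V'\times V$. Let $0<T<\infty$, $I=(0,T)$, and for a.e. $t\in I$ let $a(t;\cdot,\cdot)$ be a bilinear form on $V\times V$ such that $t\mapsto a(t;\eta,\zeta)$ is measurable for all $\eta,\zeta\in V$, and such that, with constants $M<\infty$ and $\alpha>0$ independent of $t$, for a.e. $t\in I$: $|a(t;\eta,\zeta)|\le M\|\eta\|_V\|\zeta\|_V$ and $a(t;\eta,\eta)\ge\alpha\|\eta\|_V^2$ for all $\eta,\zeta\in V$. Put $Y:=L_2(I;V)$ and $X:=L_2(I;V)\cap H^1(I;V')$ with their standard topologies, let $\gamma_t u:=u(t)\in H$ ($u\in X$, $t\in[0,T]$) be the trace defined through $X\hookrightarrow C([0,T];H)$, and set $$(Au)(v):=\int_I a(t;u(t),v(t))\,dt,\quad A_s:=\tfrac12(A+A'),\quad (\partial_t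 u)(v):=\int_I\langle \tfrac{du}{dt}(t),v(t)\rangle\,dt,\quad B:=\partial_t+A ,$$ $$\|v\|_Y^2:=(A_sv)(v),\qquad \|f\|_{Y'}:=\sup_{0\ne v\in Y}\frac{|f(v)|}{\|v\|_Y},\qquad \|u\|_X^2:=\|u\|_Y^2+\|\partial_tu\|_{Y'}^2+\|u(T)\|^2 ,$$ and, for a closed subspace $Y^\delta\subseteq Y$, $$\|u\|_{X,Y^\delta}^2:=\|u\|_Y^2+\sup_{0\ne v\in Y^\delta}\frac{(\partial_tu)(v)^2}{\|v\|_Y^2}+\|u(T)\|^2\qquad(u\in X)$$ (suprema over the empty set are $0$). **Theorem.** Assume that $A=A_s$, and let $Y^\delta\subseteq Y$, $H^\delta\subseteq H$, $X^\delta\subseteq X$ be closed subspaces with $X^\delta\subseteq Y^\delta$ and $\gamma_0(X^\delta)\subseteq H^\delta$. Let $g\in Y'$ and $u_0\in H$, and consider the Galerkin problem of finding $(\mu^\delta,\sigma^\delta,u^\delta)\in Y^\delta\times H^\delta\times X^\delta$ such that $$\begin{aligned}(A_s\mu^\delta)(v)+(Bu^\delta)(v)&=g(v)&&(v\in Y^\delta),\\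 \langle\sigma^\delta,h\rangle+\langle u^\delta(0),h\rangle&=\langle u_0,h\rangle&&(h\in H^\delta),\\ (Bw)(\mu^\delta)+\langle w(0),\sigma^\delta\rangle&=0&&(w\in X^\delta).\end{aligned}$$ 1. If $X^\delta$ is finite-dimensional or, more generally, if there is a $\kappa>0$ with $\kappa\|w\|_X\le\|w\|_{X,Y^\delta}$ for all $w\in X^\delta$, then the Galerkin problem has a unique solution. 2. For all closed subspaces as above, of finite or infinite dimension, the Galerkin problem has at most one solution. 3. For all closed subspaces as above, of finite or infinite dimension, if $(\mu^\delta,\sigma^\delta,u^\delta)$ solves the Galerkin problem and $u\in X$ is the solution of $$(Bu)(v_1)+\langle u(0),v_2\rangle=g(v_1)+\langle u_0,v_2\rangle\qquad((v_1,v_2)\in Y\times H),$$ then $$\|u-u^\delta\|_{X,Y^\delta}\le 2\inf_{\bar u^\delta\in X^\delta}\|u-\bar u^\delta\|_X .$$ -/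

import Mathlib

open MeasureTheory Set
open scoped ContDiff

namespace SpaceTime

noncomputable section

/-- Lebesgue measure on the time interval `I = (0, T)`. -/
abbrev timeMeasure (T : ℝ) : Measure ℝ := volume.restrict (Ioo 0 T)

/-- `Y = L₂(I; V)`. -/
abbrev SpaceY (V : Type*) [NormedAddCommGroup V] (T : ℝ) : Type _ :=
  Lp V 2 (timeMeasure T)

/-- `L₂(I; V')`, with `V'` the dual of `V`. -/
abbrev SpaceL2Dual (V : Type*) [NormedAddCommGroup V] [NormedSpace ℝ V] (T : ℝ) : Type _ :=
  Lp (StrongDual ℝ V) 2 (timeMeasure T)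

/-- Smooth test functions with compact support in `(0, T)`. -/
def IsTestFun (T : ℝ) (φ : ℝ → ℝ) : Prop :=
  ContDiff ℝ ∞ φ ∧ HasCompactSupport φ ∧ tsupport φ ⊆ Ioo 0 T

variable {V H : Type*} [NormedAddCommGroup V] [InnerProductSpace ℝ V]
  [NormedAddCommGroup H] [InnerProductSpace ℝ H]

/-- `w ∈ L₂(I; V')` is the weak time derivative of `u ∈ L₂(I; V)`, where `η ∈ V` is identified
with the functional `⟨j η, j ·⟩` of `V'` (Gelfand triple `V ↪ H ≃ H' ↪ V'` given by `j`). -/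
def IsWeakDeriv (j : V →L[ℝ] H) (T : ℝ) (u : SpaceY V T) (w : SpaceL2Dual V T) : Prop :=
  ∀ φ : ℝ → ℝ, IsTestFun T φ → ∀ η : V,
    ∫ t, deriv φ t * inner ℝ (j (u t)) (j η) ∂(timeMeasure T)
      = -∫ t, φ t * w t η ∂(timeMeasure T)

theorem integrable_test {T : ℝ} {f φ : ℝ → ℝ} (hf : MemLp f 2 (timeMeasure T))
    (hφ : Continuous φ) (hc : HasCompactSupport φ) :
    Integrable (fun t => φ t * f t) (timeMeasure T) := by
  obtain ⟨C, hC⟩ := hφ.bounded_above_of_compact_support hc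
  exact (hf.integrable (by norm_num)).bdd_mul (hφ.aestronglyMeasurable)
    (Filter.Eventually.of_forall hC)

theorem memLp_left (j : V →L[ℝ] H) {T : ℝ} (u : SpaceY V T) (η : V) :
    MemLp (fun t => inner ℝ (j (u t)) (j η)) 2 (timeMeasure T) := by
  have h := ((innerSL ℝ (j η)).comp j).comp_memLp' (Lp.memLp u)
  refine h.congr_norm ?_ ?_
  · have := h.1
    refine this.congr (Filter.Eventually.of_forall fun t => ?_)
    simp [real_inner_comm]
  · exact Filter.Eventually.of_forall fun t => by simp [real_inner_comm]

theorem memLp_right {T : ℝ} (w : SpaceL2Dual V T) (η : V) :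
    MemLp (fun t => w t η) 2 (timeMeasure T) :=
  (ContinuousLinearMap.apply ℝ ℝ η).comp_memLp' (Lp.memLp w)

theorem IsTestFun.integrable_left {T : ℝ} {φ : ℝ → ℝ} (hφ : IsTestFun T φ) (j : V →L[ℝ] H)
    (u : SpaceY V T) (η : V) :
    Integrable (fun t => deriv φ t * inner ℝ (j (u t)) (j η)) (timeMeasure T) :=
  integrable_test (memLp_left j u η) (hφ.1.continuous_deriv (by simp)) hφ.2.1.deriv

theorem IsTestFun.integrable_right {T : ℝ} {φ : ℝ → ℝ} (hφ : IsTestFun T φ)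
    (w : SpaceL2Dual V T) (η : V) :
    Integrable (fun t => φ t * w t η) (timeMeasure T) :=
  integrable_test (memLp_right w η) hφ.1.continuous hφ.2.1

/-- `X = L₂(I; V) ∩ H¹(I; V')`, realized as the space of pairs `(u, ∂ₜ u)`, so that its
topology is that of the norm `‖u‖_{L₂(I;V)} + ‖∂ₜ u‖_{L₂(I;V')}`. -/
def SpaceX (j : V →L[ℝ] H) (T : ℝ) : Submodule ℝ (SpaceY V T × SpaceL2Dual V T) where
  carrier := {p | IsWeakDeriv j T p.1 p.2}
  zero_mem' := by
    intro φ _ η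
    have h1 : (fun t => deriv φ t * inner ℝ (j ((0 : SpaceY V T) t)) (j η))
        =ᵐ[timeMeasure T] fun _ => 0 := by
      filter_upwards [Lp.coeFn_zero V 2 (timeMeasure T)] with t ht
      rw [ht]; simp
    have h2 : (fun t => φ t * (0 : SpaceL2Dual V T) t η)
        =ᵐ[timeMeasure T] fun _ => 0 := by
      filter_upwards [Lp.coeFn_zero (StrongDual ℝ V) 2 (timeMeasure T)] with t ht
      rw [ht]; simp
    simp only [Prod.fst_zero, Prod.snd_zero]
    rw [integral_congr_ae h1, integral_congr_ae h2]
    simp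
  add_mem' := by
    intro p q hp hq φ hφ η
    have h1 : (fun t => deriv φ t * inner ℝ (j ((p.1 + q.1) t)) (j η)) =ᵐ[timeMeasure T]
        fun t => deriv φ t * inner ℝ (j (p.1 t)) (j η)
          + deriv φ t * inner ℝ (j (q.1 t)) (j η) := by
      filter_upwards [Lp.coeFn_add p.1 q.1] with t ht
      rw [ht, Pi.add_apply, map_add, inner_add_left, mul_add]
    have h2 : (fun t => φ t * (p.2 + q.2) t η) =ᵐ[timeMeasure T]
        fun t => φ t * p.2 t η + φ t * q.2 t η := by
      filter_upwards [Lp.coeFn_add p.2 q.2] with t ht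
      rw [ht, Pi.add_apply, add_apply, mul_add]
    simp only [Prod.fst_add, Prod.snd_add]
    rw [integral_congr_ae h1, integral_congr_ae h2,
      integral_add (hφ.integrable_left j p.1 η) (hφ.integrable_left j q.1 η),
      integral_add (hφ.integrable_right p.2 η) (hφ.integrable_right q.2 η),
      hp φ hφ η, hq φ hφ η]
    ring
  smul_mem' := by
    intro c p hp φ hφ η
    have h1 : (fun t => deriv φ t * inner ℝ (j ((c • p.1) t)) (j η)) =ᵐ[timeMeasure T]
        fun t => c * (deriv φ t * inner ℝ (j (p.1 t)) (j η)) := by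
      filter_upwards [Lp.coeFn_smul c p.1] with t ht
      rw [ht, Pi.smul_apply, map_smul, real_inner_smul_left]
      ring
    have h2 : (fun t => φ t * (c • p.2) t η) =ᵐ[timeMeasure T]
        fun t => c * (φ t * p.2 t η) := by
      filter_upwards [Lp.coeFn_smul c p.2] with t ht
      rw [ht, Pi.smul_apply, smul_apply, smul_eq_mul]
      ring
    simp only [Prod.smul_fst, Prod.smul_snd]
    rw [integral_congr_ae h1, integral_congr_ae h2, integral_const_mul, integral_const_mul,
      hp φ hφ η]
    ring

/-- `c` is a representative of `u`, as a function with values in `H`, that is continuous on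
`[0, T]`. -/
def IsContRep (j : V →L[ℝ] H) (T : ℝ) (u : SpaceY V T) (c : ℝ → H) : Prop :=
  ContinuousOn c (Icc 0 T) ∧ ∀ᵐ t ∂(timeMeasure T), c t = j (u t)

open Classical in
/-- The trace `γₜ u = u(t) ∈ H` for `t ∈ [0, T]`: the value at `t` of the continuous
representative of `u`. Every `u ∈ X` has one (`X ↪ C([0, T]; H)`), and for `T > 0` its values on
`[0, T]` are unique. -/
def trace (j : V →L[ℝ] H) (T t : ℝ) (u : SpaceX j T) : H :=
  if h : ∃ c, IsContRep j T u.1.1 c then h.choose t else 0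

/-- `(A u)(v) = ∫_I a(t; u(t), v(t)) dt`. -/
def opA (a : ℝ → V →ₗ[ℝ] V →ₗ[ℝ] ℝ) (T : ℝ) (u v : SpaceY V T) : ℝ :=
  ∫ t, a t (u t) (v t) ∂(timeMeasure T)

/-- `A_s = (A + A') / 2`. -/
def opAs (a : ℝ → V →ₗ[ℝ] V →ₗ[ℝ] ℝ) (T : ℝ) (u v : SpaceY V T) : ℝ :=
  (1 / 2) * (opA a T u v + opA a T v u)

/-- `(∂ₜ u)(v) = ∫_I ⟨u'(t), v(t)⟩ dt`. -/
def opDt (j : V →L[ℝ] H) (T : ℝ) (u : SpaceX j T) (v : SpaceY V T) : ℝ :=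
  ∫ t, u.1.2 t (v t) ∂(timeMeasure T)

/-- `(B u)(v) = ∫_I ⟨u'(t), v(t)⟩ + a(t; u(t), v(t)) dt`. -/
def opB (j : V →L[ℝ] H) (a : ℝ → V →ₗ[ℝ] V →ₗ[ℝ] ℝ) (T : ℝ) (u : SpaceX j T)
    (v : SpaceY V T) : ℝ :=
  ∫ t, (u.1.2 t (v t) + a t (u.1.1 t) (v t)) ∂(timeMeasure T)

/-- The energy norm `‖v‖_Y = (A_s v)(v)^{1/2}`. -/
def normY (a : ℝ → V →ₗ[ℝ] V →ₗ[ℝ] ℝ) (T : ℝ) (v : SpaceY V T) : ℝ :=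
  √(opAs a T v v)

/-- `‖f‖_{Y'} = sup_{0 ≠ v ∈ Y} |f(v)| / ‖v‖_Y`, the dual of the energy norm. -/
def normYDual (a : ℝ → V →ₗ[ℝ] V →ₗ[ℝ] ℝ) (T : ℝ) (f : SpaceY V T → ℝ) : ℝ :=
  ⨆ v : {v : SpaceY V T // v ≠ 0}, |f v| / normY a T v

/-- `‖u‖_X² = ‖u‖_Y² + ‖∂ₜ u‖_{Y'}² + ‖u(T)‖²`. -/
def normX (j : V →L[ℝ] H) (a : ℝ → V →ₗ[ℝ] V →ₗ[ℝ] ℝ) (T : ℝ) (u : SpaceX j T) : ℝ :=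
  √(normY a T u.1.1 ^ 2 + normYDual a T (opDt j T u) ^ 2 + ‖trace j T T u‖ ^ 2)

/-- The mesh-dependent norm,
`‖u‖_{X,Yδ}² = ‖u‖_Y² + sup_{0 ≠ v ∈ Yδ} (∂ₜ u)(v)² / ‖v‖_Y² + ‖u(T)‖²`. -/
def normXY (j : V →L[ℝ] H) (a : ℝ → V →ₗ[ℝ] V →ₗ[ℝ] ℝ) (T : ℝ)
    (Yd : Submodule ℝ (SpaceY V T)) (u : SpaceX j T) : ℝ :=
  √(normY a T u.1.1 ^ 2
    + (⨆ v : {v : SpaceY V T // v ∈ Yd ∧ v ≠ 0}, opDt j T u v ^ 2 / normY a T v ^ 2)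
    + ‖trace j T T u‖ ^ 2)

/-- `u ∈ X` solves `(B u)(v₁) + ⟨u(0), v₂⟩ = g(v₁) + ⟨u₀, v₂⟩` for all `(v₁, v₂) ∈ Y × H`. -/
def IsExactSolution (j : V →L[ℝ] H) (a : ℝ → V →ₗ[ℝ] V →ₗ[ℝ] ℝ) (T : ℝ)
    (g : StrongDual ℝ (SpaceY V T)) (u₀ : H) (u : SpaceX j T) : Prop :=
  ∀ (v₁ : SpaceY V T) (v₂ : H),
    opB j a T u v₁ + inner ℝ (trace j T 0 u) v₂ = g v₁ + inner ℝ u₀ v₂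

/-- `(μ, σ, u) ∈ Yδ × Hδ × Xδ` solves the Galerkin discretization of the self-adjoint saddle
point system with operator matrix `[A_s, 0, B; 0, Id, γ₀; B', γ₀', 0]` and right-hand side
`[g, u₀, 0]`. -/
def IsGalerkinSolution (j : V →L[ℝ] H) (a : ℝ → V →ₗ[ℝ] V →ₗ[ℝ] ℝ) (T : ℝ)
    (Yd : Submodule ℝ (SpaceY V T)) (Hd : Submodule ℝ H) (Xd : Submodule ℝ (SpaceX j T))
    (g : StrongDual ℝ (SpaceY V T)) (u₀ : H) (p : Yd × Hd × Xd) : Prop :=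
  (∀ v ∈ Yd, opAs a T p.1 v + opB j a T p.2.2 v = g v) ∧
  (∀ h ∈ Hd, inner ℝ (p.2.1 : H) h + inner ℝ (trace j T 0 p.2.2) h = inner ℝ u₀ h) ∧
  (∀ w ∈ Xd, opB j a T w p.1 + inner ℝ (trace j T 0 w) (p.2.1 : H) = 0)

end

end SpaceTime

namespace SpaceTime

/-! The energy form of `A_s` turns `Y` into a Hilbert space `Z` via an isomorphism `e`. In `Z`,
Riesz representation replaces `∂ₜ` by an operator `D`, and, because `A = A_s`, it replaces `A` by `c
u = e u`; thus `B u` becomes `D u + c u`. Expanding the square and using the energy identity `2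
(∂ₜu)(u) = ‖u(T)‖² - ‖u(0)‖²` gives `‖B u‖² + ‖u(0)‖² = ‖u‖_X²`. If `P` is the projection onto the
image of `Yδ` and `u ∈ Yδ`, the projection does not change the cross term, so `‖P B u‖² + ‖u(0)‖² =
‖u‖_{X,Yδ}²` (`norm_residual_sq`, `norm_residual_sq_top`).

The Galerkin system is therefore a least-squares problem for `w ↦ (P B w, w(0))` on `Xδ`, with `μ`
and `σ` the projected residuals. Existence follows by projecting onto the range of this map, which
is closed in finite dimension or under the `κ` bound (`exists_isSaddlePoint`). Uniqueness needs only
test functions and the energy identity (`IsSaddlePoint.unique`). In the error bound, orthogonality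
of the residual gives `‖uδ - w‖_{X,Yδ} ≤ ‖u - w‖_X` for `w ∈ Xδ`, and the triangle inequality
supplies the factor 2 (`IsSaddlePoint.error_le`).

The analytic input is the trace embedding with its energy identity (`exists_isContRep`). Compactness
of `j` yields bases of `V` and `H` in which `j` is diagonal; every coefficient is then a scalar
absolutely continuous function, and Parseval sums the scalar identities. -/

/-! ### Hilbert bases that diagonalize the embedding. -/

/-- Distinct members lie at distance `√2`, so the balls of radius 1/2 are disjoint. Countability
later permits uniting null sets and summing integrals over the modes. -/
theorem countable_of_orthonormal {ι E : Type*} [NormedAddCommGroup E] [InnerProductSpace ℝ E]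
    [TopologicalSpace.SeparableSpace E] {v : ι → E} (hv : Orthonormal ℝ v) : Countable ι := by
  rw [← Set.countable_univ_iff]
  refine Set.PairwiseDisjoint.countable_of_isOpen (s := fun i => Metric.ball (v i) (1 / 2)) ?_
    (fun _ _ => Metric.isOpen_ball) (fun _ _ => ⟨v _, Metric.mem_ball_self (by norm_num)⟩)
  intro i _ k _ hik
  refine Metric.ball_disjoint_ball ?_
  have h : ‖v i - v k‖ ^ 2 = 2 := by
    rw [norm_sub_sq_real, hv.1, hv.1, hv.2 hik]; norm_num
  rw [dist_eq_norm]
  nlinarith [norm_nonneg (v i - v k)]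

/-- A compact self-adjoint operator has a Hilbert basis of eigenvectors. -/
theorem exists_hilbertBasis_eigenvectors.{u} {E : Type u} [NormedAddCommGroup E]
    [InnerProductSpace ℝ E] [CompleteSpace E] {S : E →L[ℝ] E} (hS : IsCompactOperator S)
    (hS' : S.IsSymmetric) :
    ∃ (ι : Type u) (b : HilbertBasis ι ℝ E) (l : ι → ℝ), ∀ i, S (b i) = l i • b i := by
  let F : ℝ → Submodule ℝ E := fun μ => Module.End.eigenspace (S : Module.End ℝ E) μ
  have hF : ∀ μ, IsClosed (F μ : Set E) := by
    intro μ
    have : (F μ : Set E) = {x | S x = μ • x} := by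
      ext x; simp [F]
    rw [this]
    exact isClosed_eq S.continuous (continuous_const_smul μ)
  have : ∀ μ, CompleteSpace (F μ) := fun μ => (hF μ).completeSpace_coe
  -- The bases of all eigenspaces are glued, the kernel included; a real number that is not an
  -- eigenvalue contributes an empty index set.
  choose w b hb using fun μ => exists_hilbertBasis ℝ (F μ)
  have ho : Orthonormal ℝ (fun a : Σ μ, w μ => (F a.1).subtypeₗᵢ (b a.1 a.2)) :=
    hS'.orthogonalFamily_eigenspaces.orthonormal_sigma_orthonormal fun μ => (b μ).orthonormal
  refine ⟨Σ μ, w μ, HilbertBasis.mkOfOrthogonalEqBot ho ?_, fun a => a.1, fun a => ?_⟩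
  · rw [eq_bot_iff,
      ← ContinuousLinearMap.orthogonalComplement_iSup_eigenspaces_eq_bot hS hS']
    intro x hx
    rw [Submodule.mem_orthogonal'] at hx ⊢
    intro y hy
    have hle : (⨆ μ, F μ) ≤ LinearMap.ker (innerSL ℝ x : E →L[ℝ] ℝ).toLinearMap := by
      refine iSup_le fun μ z hz => ?_
      have h1 := ((b μ).hasSum_repr ⟨z, hz⟩).mapL ((innerSL ℝ x).comp (F μ).subtypeL)
      have h2 : ∀ i, ((innerSL ℝ x).comp (F μ).subtypeL) ((b μ).repr ⟨z, hz⟩ i • b μ i) = 0 := by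
        intro i
        have := hx _ (Submodule.subset_span ⟨⟨μ, i⟩, rfl⟩)
        rw [map_smul]
        simp only [ContinuousLinearMap.comp_apply, innerSL_apply_apply]
        exact smul_eq_zero_of_right _ this
      simp only [h2] at h1
      exact h1.unique hasSum_zero
    exact hle hy
  · rw [HilbertBasis.coe_mkOfOrthogonalEqBot]
    exact Module.End.mem_eigenspace_iff.1 (b a.1 a.2).2

/-- A compact dense embedding `j : V → H` of Hilbert spaces is diagonal with respect to suitable
Hilbert bases of `V` and `H`. -/
theorem exists_hilbertBasis_diagonal.{u, v} {V : Type u} {H : Type v}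
    [NormedAddCommGroup V] [InnerProductSpace ℝ V] [CompleteSpace V]
    [NormedAddCommGroup H] [InnerProductSpace ℝ H] [CompleteSpace H]
    (j : V →L[ℝ] H) (hj_inj : Function.Injective j) (hj_dense : DenseRange j)
    (hj_compact : IsCompactOperator j) :
    ∃ (ι : Type u) (b : HilbertBasis ι ℝ V) (e : HilbertBasis ι ℝ H) (l : ι → ℝ),
      (∀ i, 0 < l i) ∧ (∀ i, j (b i) = l i • e i) ∧
      ∀ i v, inner ℝ (j v) (e i) = l i * inner ℝ (b i) v := by
  -- An eigenbasis of `j* j` stays orthogonal under `j`; normalizing the images gives the basis of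
  -- `H`, with the singular values `√(m i)` as factors.
  let S : V →L[ℝ] V := (ContinuousLinearMap.adjoint j).comp j
  have hSi : ∀ x y, inner ℝ (S x) y = inner ℝ (j x) (j y) := fun x y => by
    simp [S, ContinuousLinearMap.adjoint_inner_left]
  have hS : IsCompactOperator S := hj_compact.clm_comp (ContinuousLinearMap.adjoint j)
  have hS' : S.IsSymmetric := fun x y => by
    exact (hSi x y).trans ((real_inner_comm _ _).trans
      ((hSi y x).symm.trans (real_inner_comm _ _)))
  obtain ⟨ι, b, m, hm⟩ := exists_hilbertBasis_eigenvectors hS hS'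
  have hji : ∀ i v, inner ℝ (j (b i)) (j v) = m i * inner ℝ (b i) v := fun i v => by
    rw [← hSi, hm, real_inner_smul_left]
  have hm0 : ∀ i, 0 < m i := by
    intro i
    have h := hji i (b i)
    rw [real_inner_self_eq_norm_sq, real_inner_self_eq_norm_sq, b.orthonormal.1 i] at h
    have : j (b i) ≠ 0 := by
      intro h0
      have := hj_inj (h0.trans (map_zero j).symm)
      simpa [this] using b.orthonormal.1 i
    have : 0 < ‖j (b i)‖ ^ 2 := by positivity
    linarith
  have hl : ∀ i, 0 < √(m i) := fun i => Real.sqrt_pos.2 (hm0 i)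
  have ho : Orthonormal ℝ (fun i => (√(m i))⁻¹ • j (b i)) := by
    classical
    rw [orthonormal_iff_ite]
    intro i k
    rw [real_inner_smul_left, real_inner_smul_right, hji,
      orthonormal_iff_ite.1 b.orthonormal i k]
    split_ifs with h
    · subst h
      have := Real.mul_self_sqrt (hm0 i).le
      have := hl i
      field_simp
      nlinarith
    · simp
  have hd : (Submodule.span ℝ (Set.range fun i => (√(m i))⁻¹ • j (b i)))ᗮ = ⊥ := by
    rw [eq_bot_iff]
    intro x hx
    rw [Submodule.mem_orthogonal'] at hx
    have h1 : ContinuousLinearMap.adjoint j x = 0 := by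
      have h2 : ∀ i, inner ℝ (b i) (ContinuousLinearMap.adjoint j x) = 0 := by
        intro i
        have := hx _ (Submodule.subset_span ⟨i, rfl⟩)
        rw [real_inner_smul_right] at this
        rw [ContinuousLinearMap.adjoint_inner_right, real_inner_comm]
        exact (mul_eq_zero.1 this).resolve_left (inv_ne_zero (hl i).ne')
      have h3 := b.hasSum_repr (ContinuousLinearMap.adjoint j x)
      simp only [b.repr_apply_apply, h2, zero_smul] at h3
      exact h3.unique hasSum_zero
    have h4 : ∀ v, inner ℝ x (j v) = 0 := fun v => by
      rw [← ContinuousLinearMap.adjoint_inner_left, h1, inner_zero_left]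
    have h5 : (fun y => inner ℝ x y) = fun _ => (0 : ℝ) :=
      hj_dense.equalizer (by fun_prop) continuous_const (funext h4)
    exact inner_self_eq_zero.1 (congrFun h5 x)
  refine ⟨ι, b, HilbertBasis.mkOfOrthogonalEqBot ho hd, fun i => √(m i), hl, fun i => ?_,
    fun i v => ?_⟩
  · simp [smul_smul, mul_inv_cancel₀ (hl i).ne']
  · rw [HilbertBasis.coe_mkOfOrthogonalEqBot, real_inner_smul_right, real_inner_comm, hji]
    have := Real.mul_self_sqrt (hm0 i).le
    have := hl i
    field_simp
    rw [Real.sq_sqrt (hm0 i).le]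

/-! ### Scalar weak derivatives on `(0, T)`. -/

theorem integral_timeMeasure {T : ℝ} (hT : 0 < T) (f : ℝ → ℝ) :
    ∫ t, f t ∂(timeMeasure T) = ∫ t in (0 : ℝ)..T, f t := by
  rw [intervalIntegral.integral_of_le hT.le, integral_Ioc_eq_integral_Ioo]

theorem intervalIntegrable_of_timeMeasure {T : ℝ} (hT : 0 < T) {f : ℝ → ℝ}
    (hf : Integrable f (timeMeasure T)) : IntervalIntegrable f volume 0 T := by
  rw [intervalIntegrable_iff_integrableOn_Ioo_of_le hT.le]
  exact hf

theorem IsTestFun.eq_zero {T : ℝ} {φ : ℝ → ℝ} (hφ : IsTestFun T φ) {t : ℝ} (ht : t ∉ Ioo 0 T) :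
    φ t = 0 :=
  image_eq_zero_of_notMem_tsupport fun h => ht (hφ.2.2 h)

/-- A test function with vanishing integral is the derivative of a test function. -/
theorem IsTestFun.exists_antideriv {T : ℝ} (hT : 0 < T) {ψ : ℝ → ℝ} (hψ : IsTestFun T ψ)
    (h0 : ∫ t, ψ t ∂(timeMeasure T) = 0) : ∃ φ, IsTestFun T φ ∧ deriv φ = ψ := by
  have hc : Continuous ψ := hψ.1.continuous
  obtain ⟨p, q, hp, hq, hpq⟩ : ∃ p q : ℝ, 0 < p ∧ q < T ∧ tsupport ψ ⊆ Icc p q := by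
    rcases (tsupport ψ).eq_empty_or_nonempty with h | h
    -- For `ψ = 0` only `0 < p` and `q < T` matter; the interval `[p, q]` may be empty.
    · exact ⟨1, T - 1, one_pos, by linarith, by simp [h]⟩
    · have hK : IsCompact (tsupport ψ) := hψ.2.1
      exact ⟨_, _, (hψ.2.2 (hK.sInf_mem h)).1, (hψ.2.2 (hK.sSup_mem h)).2,
        fun t ht => ⟨csInf_le hK.bddBelow ht, le_csSup hK.bddAbove ht⟩⟩
  let φ : ℝ → ℝ := fun t => ∫ s in (0 : ℝ)..t, ψ s
  have hd : ∀ t, HasDerivAt φ (ψ t) t := fun t =>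
    intervalIntegral.integral_hasDerivAt_right (hc.intervalIntegrable _ _)
      hc.aestronglyMeasurable.stronglyMeasurableAtFilter hc.continuousAt
  have hdφ : deriv φ = ψ := funext fun t => (hd t).deriv
  have hz : ∀ t, t ∉ Icc p q → ψ t = 0 := fun t ht =>
    image_eq_zero_of_notMem_tsupport fun h => ht (hpq h)
  have hs : tsupport φ ⊆ Icc p q := by
    refine closure_minimal (fun t ht => ?_) isClosed_Icc
    by_contra htn
    refine ht ?_
    rw [mem_Icc, not_and_or, not_le, not_le] at htn
    rcases htn with h | h
    · have : ∀ s ∈ uIcc 0 t, ψ s = (fun _ => 0) s := fun s hs => hz s fun hs' => by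
        have := hs.2
        have := hs'.1
        have : max 0 t < p := max_lt hp h
        linarith
      exact (intervalIntegral.integral_congr this).trans intervalIntegral.integral_zero
    -- To the right of `q` the primitive equals the total integral of `ψ`, which is zero.
    · have : ∀ s ∈ uIcc t T, ψ s = (fun _ => 0) s := fun s hs => hz s fun hs' => by
        have := hs.1
        have := hs'.2
        have : q < min t T := lt_min h hq
        linarith
      have h1 : ∫ s in t..T, ψ s = 0 :=
        (intervalIntegral.integral_congr this).trans intervalIntegral.integral_zero
      rw [integral_timeMeasure hT] at h0
      have h2 := intervalIntegral.integral_add_adjacent_intervals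
        (hc.intervalIntegrable (μ := volume) 0 t) (hc.intervalIntegrable t T)
      change ∫ s in (0 : ℝ)..t, ψ s = 0
      linarith
  refine ⟨φ, ⟨?_, HasCompactSupport.of_support_subset_isCompact isCompact_Icc
    ((subset_tsupport φ).trans hs), hs.trans fun t ht => ⟨hp.trans_le ht.1, ht.2.trans_lt hq⟩⟩, hdφ⟩
  rw [contDiff_infty_iff_deriv, hdφ]
  exact ⟨fun t => (hd t).differentiableAt, hψ.1⟩

theorem exists_isTestFun_integral_eq_one {T : ℝ} (hT : 0 < T) :
    ∃ χ, IsTestFun T χ ∧ ∫ t, χ t ∂(timeMeasure T) = 1 := by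
  let B : ContDiffBump (T / 2) := ⟨T / 8, T / 4, by positivity, by linarith⟩
  have hs : tsupport (B.normed volume) ⊆ Ioo 0 T := by
    rw [B.tsupport_normed_eq, Real.closedBall_eq_Icc]
    intro t ht
    have h1 : T / 2 - T / 4 ≤ t := ht.1
    have h2 : t ≤ T / 2 + T / 4 := ht.2
    constructor <;> linarith
  refine ⟨B.normed volume, ⟨B.contDiff_normed, B.hasCompactSupport_normed, hs⟩, ?_⟩
  rw [setIntegral_eq_integral_of_forall_compl_eq_zero, B.integral_normed]
  exact fun t ht => image_eq_zero_of_notMem_tsupport fun h => ht (hs h)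

/-- Du Bois-Reymond: a function whose weak derivative vanishes is constant. -/
theorem ae_eq_const_of_integral_deriv_mul_eq_zero {T : ℝ} (hT : 0 < T) {h : ℝ → ℝ}
    (hh : Integrable h (timeMeasure T))
    (hw : ∀ φ, IsTestFun T φ → ∫ t, deriv φ t * h t ∂(timeMeasure T) = 0) :
    ∃ C : ℝ, ∀ᵐ t ∂(timeMeasure T), h t = C := by
  have hmul : ∀ {φ : ℝ → ℝ}, IsTestFun T φ → ∀ {k : ℝ → ℝ}, Integrable k (timeMeasure T) →
      Integrable (fun t => φ t * k t) (timeMeasure T) := fun {φ} hφ k hk => by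
    obtain ⟨C, hC⟩ := hφ.1.continuous.bounded_above_of_compact_support hφ.2.1
    exact hk.bdd_mul hφ.1.continuous.aestronglyMeasurable (Filter.Eventually.of_forall hC)
  obtain ⟨χ, hχ, hχ1⟩ := exists_isTestFun_integral_eq_one hT
  refine ⟨∫ t, χ t * h t ∂(timeMeasure T), ?_⟩
  set C := ∫ t, χ t * h t ∂(timeMeasure T)
  have hhC : Integrable (fun t => h t - C) (timeMeasure T) := hh.sub (integrable_const C)
  have key := isOpen_Ioo.ae_eq_zero_of_integral_contDiff_smul_eq_zero (μ := volume)
    (f := fun t => h t - C) (U := Ioo 0 T) (IntegrableOn.locallyIntegrableOn hhC) ?_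
  · rw [ae_restrict_iff' measurableSet_Ioo]
    filter_upwards [key] with t ht hmem
    exact sub_eq_zero.1 (ht hmem)
  intro ψ hψ1 hψ2 hψ3
  have hψ : IsTestFun T ψ := ⟨hψ1, hψ2, hψ3⟩
  have hone : Integrable (fun _ : ℝ => (1 : ℝ)) (timeMeasure T) := integrable_const _
  have hψi : Integrable ψ (timeMeasure T) := by simpa using hmul hψ hone
  have hχi : Integrable χ (timeMeasure T) := by simpa using hmul hχ hone
  set m := ∫ t, ψ t ∂(timeMeasure T)
  -- Subtracting `m χ` makes the mean zero, so the difference is a derivative of a test function and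
  -- can be used in `hw`.
  have htest : IsTestFun T (fun t => ψ t - m * χ t) := by
    refine ⟨hψ1.sub (contDiff_const.mul hχ.1), hψ2.sub hχ.2.1.mul_left, ?_⟩
    refine (tsupport_sub ψ (fun t => m * χ t)).trans (union_subset hψ3 ?_)
    exact (tsupport_mul_subset_right (f := fun _ => m) (g := χ)).trans hχ.2.2
  obtain ⟨φ, hφ, hφd⟩ := htest.exists_antideriv hT (by
    rw [integral_sub hψi (hχi.const_mul m), integral_const_mul, hχ1]; simp [m])
  have h1 := hw φ hφ
  have h2 : (fun t => deriv φ t * h t) = fun t => ψ t * h t - m * (χ t * h t) := by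
    funext t; rw [hφd]; ring
  rw [h2, integral_sub (hmul hψ hh) ((hmul hχ hh).const_mul m), integral_const_mul] at h1
  have h3 : ∫ t, ψ t • (h t - C) = ∫ t, ψ t * (h t - C) ∂(timeMeasure T) := by
    rw [setIntegral_eq_integral_of_forall_compl_eq_zero]
    · simp
    · intro t ht; rw [hψ.eq_zero ht, zero_mul]
  rw [h3]
  have h4 : (fun t => ψ t * (h t - C)) = fun t => ψ t * h t - C * ψ t := by
    funext t; ring
  rw [h4, integral_sub (hmul hψ hh) (hψi.const_mul C), integral_const_mul]
  linarith

theorem IsTestFun.absolutelyContinuous {T : ℝ} {φ : ℝ → ℝ} (hφ : IsTestFun T φ) (a b : ℝ) :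
    AbsolutelyContinuousOnInterval φ a b :=
  (hφ.1.of_le (by exact_mod_cast le_top) : ContDiff ℝ 1 φ).contDiffOn.absolutelyContinuousOnInterval

/-- A function with an integrable weak derivative `g` has a continuous representative, which
satisfies `(F²)' = 2 f g` in integrated form. -/
theorem exists_continuous_rep {T : ℝ} (hT : 0 < T) {f g : ℝ → ℝ}
    (hf : Integrable f (timeMeasure T)) (hg : Integrable g (timeMeasure T))
    (hw : ∀ φ, IsTestFun T φ →
      ∫ t, deriv φ t * f t ∂(timeMeasure T) = -∫ t, φ t * g t ∂(timeMeasure T)) :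
    ∃ F : ℝ → ℝ, ContinuousOn F (Icc 0 T) ∧ (∀ᵐ t ∂(timeMeasure T), F t = f t) ∧
      ∀ s ∈ Icc 0 T, ∀ t ∈ Icc 0 T, F t ^ 2 - F s ^ 2 = ∫ r in s..t, 2 * (f r * g r) := by
  have hgI := intervalIntegrable_of_timeMeasure hT hg
  -- The primitive of `g` has weak derivative `g`, so `f - G` is a.e. a constant `C`, and `C + G` is
  -- the representative.
  let G : ℝ → ℝ := fun t => ∫ s in (0 : ℝ)..t, g s
  have hGac : AbsolutelyContinuousOnInterval G 0 T :=
    hgI.absolutelyContinuousOnInterval_intervalIntegral (by simp)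
  have hGd : ∀ᵐ t, t ∈ uIcc 0 T → HasDerivAt G (g t) t := by
    filter_upwards [hgI.ae_hasDerivAt_integral] with t ht hmem
    exact ht hmem 0 (by simp)
  have hGi : Integrable G (timeMeasure T) := by
    have : IntegrableOn G (Icc 0 T) := by
      have := hGac.continuousOn
      rw [uIcc_of_le hT.le] at this
      exact this.integrableOn_Icc
    exact this.mono_set Ioo_subset_Icc_self
  have hGw : ∀ φ, IsTestFun T φ →
      ∫ t, deriv φ t * G t ∂(timeMeasure T) = -∫ t, φ t * g t ∂(timeMeasure T) := by
    intro φ hφ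
    have h1 := (hφ.absolutelyContinuous 0 T).integral_mul_deriv_eq_deriv_mul hGac
    rw [hφ.eq_zero (by simp : (0 : ℝ) ∉ Ioo 0 T), hφ.eq_zero (by simp : T ∉ Ioo 0 T)] at h1
    have h2 : ∫ t in (0 : ℝ)..T, φ t * deriv G t = ∫ t in (0 : ℝ)..T, φ t * g t := by
      refine intervalIntegral.integral_congr_ae ?_
      filter_upwards [hGd] with t ht hmem
      rw [(ht (uIoc_subset_uIcc hmem)).deriv]
    rw [integral_timeMeasure hT, integral_timeMeasure hT]
    linarith
  obtain ⟨C, hC⟩ := ae_eq_const_of_integral_deriv_mul_eq_zero hT (hf.sub hGi) (by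
    intro φ hφ
    have hmul : ∀ {k : ℝ → ℝ}, Integrable k (timeMeasure T) →
        Integrable (fun t => deriv φ t * k t) (timeMeasure T) := fun {k} hk => by
      have hc := hφ.1.continuous_deriv (by simp)
      obtain ⟨C, hC⟩ := hc.bounded_above_of_compact_support hφ.2.1.deriv
      exact hk.bdd_mul hc.aestronglyMeasurable (Filter.Eventually.of_forall hC)
    have : (fun t => deriv φ t * (f - G) t) = fun t => deriv φ t * f t - deriv φ t * G t := by
      funext t; simp [mul_sub]
    rw [this, integral_sub (hmul hf) (hmul hGi), hw φ hφ, hGw φ hφ, sub_self])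
  have hCac : AbsolutelyContinuousOnInterval (fun t => C + G t) 0 T :=
    ((contDiff_const (c := C) (n := 1)).contDiffOn.absolutelyContinuousOnInterval).add hGac
  have hCf : ∀ᵐ t ∂(timeMeasure T), C + G t = f t := by
    filter_upwards [hC] with t ht
    rw [← ht]; simp
  refine ⟨fun t => C + G t, ?_, hCf, ?_⟩
  · have := hCac.continuousOn
    rwa [uIcc_of_le hT.le] at this
  · intro s hs t ht
    have hsub : uIcc s t ⊆ uIcc 0 T := by
      rw [uIcc_of_le hT.le]; exact uIcc_subset_Icc hs ht
    have hac := hCac.mono hsub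
    have h1 := hac.integral_deriv_mul_eq_sub hac
    have h2 : ∫ r in s..t, 2 * (f r * g r)
        = ∫ x in s..t, deriv (fun t => C + G t) x * (C + G x)
          + (C + G x) * deriv (fun t => C + G t) x := by
      refine intervalIntegral.integral_congr_ae ?_
      rw [ae_restrict_iff' measurableSet_Ioo] at hCf
      filter_upwards [hGd, hCf, compl_mem_ae_iff.2 (measure_singleton (μ := volume) (0 : ℝ)),
        compl_mem_ae_iff.2 (measure_singleton (μ := volume) T)] with r hr1 hr2 hr3 hr4 hr
      have hr' := hsub (uIoc_subset_uIcc hr)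
      have hm : r ∈ Ioo 0 T := by
        rw [uIcc_of_le hT.le] at hr'
        exact ⟨lt_of_le_of_ne hr'.1 (Ne.symm hr3), lt_of_le_of_ne hr'.2 hr4⟩
      rw [((hr1 hr').const_add C).deriv, hr2 hm]
      ring
    rw [h2, h1]
    ring

/-! ### Norms in `L₂` and Parseval identities. -/

theorem norm_Lp_two_sq {α E : Type*} [MeasurableSpace α] {μ : Measure α} [NormedAddCommGroup E]
    (f : Lp E 2 μ) : ‖f‖ ^ 2 = ∫ t, ‖f t‖ ^ 2 ∂μ := by
  have h0 : 0 ≤ ∫ t, ‖f t‖ ^ 2 ∂μ := integral_nonneg fun _ => by positivity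
  rw [Lp.norm_def, (Lp.memLp f).eLpNorm_eq_integral_rpow_norm (by norm_num) (by norm_num),
    ENNReal.toReal_ofReal (by positivity)]
  simp only [ENNReal.toReal_ofNat, Real.rpow_ofNat]
  rw [← Real.rpow_natCast, ← Real.rpow_mul h0]
  norm_num

theorem integrable_norm_sq_Lp {α E : Type*} [MeasurableSpace α] {μ : Measure α}
    [NormedAddCommGroup E] (f : Lp E 2 μ) : Integrable (fun t => ‖f t‖ ^ 2) μ :=
  (memLp_two_iff_integrable_sq_norm (Lp.memLp f).1).1 (Lp.memLp f)

theorem hasSum_inner_sq {ι E : Type*} [NormedAddCommGroup E] [InnerProductSpace ℝ E]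
    (b : HilbertBasis ι ℝ E) (x : E) : HasSum (fun i => inner ℝ (b i) x ^ 2) (‖x‖ ^ 2) := by
  have := b.hasSum_inner_mul_inner x x
  rw [real_inner_self_eq_norm_sq] at this
  refine this.congr_fun ?_
  intro i
  rw [real_inner_comm, sq]

theorem hasSum_dual_sq {ι E : Type*} [NormedAddCommGroup E] [InnerProductSpace ℝ E]
    [CompleteSpace E] (b : HilbertBasis ι ℝ E) (f : StrongDual ℝ E) :
    HasSum (fun i => f (b i) ^ 2) (‖f‖ ^ 2) := by
  have := hasSum_inner_sq b ((InnerProductSpace.toDual ℝ E).symm f)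
  rw [LinearIsometryEquiv.norm_map] at this
  refine this.congr_fun fun i => ?_
  rw [real_inner_comm, InnerProductSpace.toDual_symm_apply]

theorem hasSum_dual_mul_inner {ι E : Type*} [NormedAddCommGroup E] [InnerProductSpace ℝ E]
    (b : HilbertBasis ι ℝ E) (f : StrongDual ℝ E) (x : E) :
    HasSum (fun i => inner ℝ (b i) x * f (b i)) (f x) := by
  have := (b.hasSum_repr x).mapL f
  simpa [b.repr_apply_apply] using this

/-! ### The embedding of `X` into `C([0, T]; H)` and the traces. -/

section TraceEmbedding

variable {V H : Type*} [NormedAddCommGroup V] [InnerProductSpace ℝ V]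
  [NormedAddCommGroup H] [InnerProductSpace ℝ H]

/-- Scalar modes of an element of `X`: each has a continuous representative, controlled by the
norm densities of the mode. -/
theorem exists_mode_rep {j : V →L[ℝ] H} {T : ℝ} (hT : 0 < T) {u : SpaceY V T}
    {w : SpaceL2Dual V T} (huw : IsWeakDeriv j T u w) {l : ℝ} (hl : 0 < l) {η : V} {ε : H}
    (hη : j η = l • ε) (hε : ∀ v, inner ℝ (j v) ε = l * inner ℝ η v) {R : ℝ} (hR : l ≤ R) :
    ∃ F : ℝ → ℝ, ContinuousOn F (Icc 0 T) ∧
      (∀ᵐ t ∂(timeMeasure T), F t = inner ℝ (j (u t)) ε) ∧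
      (∀ t ∈ Icc 0 T, F t ^ 2
        ≤ ∫ s, ((R ^ 2 / T + 1) * inner ℝ η (u s) ^ 2 + w s η ^ 2) ∂(timeMeasure T)) ∧
      F T ^ 2 - F 0 ^ 2 = ∫ s, 2 * (inner ℝ η (u s) * w s η) ∂(timeMeasure T) := by
  have hx : MemLp (fun t => inner ℝ η (u t)) 2 (timeMeasure T) :=
    (innerSL ℝ η).comp_memLp' (Lp.memLp u)
  have hw := memLp_right w η
  have hx1 : Integrable (fun t => inner ℝ η (u t)) (timeMeasure T) := hx.integrable (by norm_num)
  have hw1 : Integrable (fun t => w t η) (timeMeasure T) := hw.integrable (by norm_num)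
  have hx2 : Integrable (fun t => inner ℝ η (u t) ^ 2) (timeMeasure T) := hx.integrable_sq
  have hw2 : Integrable (fun t => w t η ^ 2) (timeMeasure T) := hw.integrable_sq
  have hxw : Integrable (fun t => inner ℝ η (u t) * w t η) (timeMeasure T) := hx.integrable_mul hw
  -- The coefficient is `l ⟨η, u⟩`; testing with `η`, where `j η = l ε`, makes its derivative `l⁻¹
  -- w(η)`. The factors cancel in the product, so the energy density does not depend on `l`.
  obtain ⟨F, hF1, hF2, hF3⟩ := exists_continuous_rep hT (hx1.const_mul l) (hw1.const_mul l⁻¹) (by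
    intro φ hφ
    have h := huw φ hφ η
    have e1 : (fun t => deriv φ t * inner ℝ (j (u t)) (j η))
        = fun t => l * (deriv φ t * (l * inner ℝ η (u t))) := by
      funext t
      rw [hη, real_inner_smul_right, hε]; ring
    have e2 : (fun t => φ t * (l⁻¹ * w t η)) = fun t => l⁻¹ * (φ t * w t η) := by
      funext t; ring
    rw [e1, integral_const_mul] at h
    rw [e2, integral_const_mul]
    rw [← mul_right_inj' hl.ne', h, mul_neg, ← mul_assoc, mul_inv_cancel₀ hl.ne', one_mul])
  have hprod : ∀ r, 2 * (l * inner ℝ η (u r) * (l⁻¹ * w r η)) = 2 * (inner ℝ η (u r) * w r η) := by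
    intro r; field_simp
  simp only [hprod] at hF3
  refine ⟨F, hF1, ?_, ?_, ?_⟩
  · filter_upwards [hF2] with t ht
    rw [ht, hε]
  · intro t ht
    set Q := ∫ s, (inner ℝ η (u s) ^ 2 + w s η ^ 2) ∂(timeMeasure T) with hQ
    have hb : ∀ s ∈ Icc 0 T, F t ^ 2 ≤ F s ^ 2 + Q := by
      intro s hs
      have h1 : ∫ r in s..t, 2 * (inner ℝ η (u r) * w r η) ≤ Q := by
        refine (le_abs_self _).trans ?_
        rw [← Real.norm_eq_abs]
        refine (intervalIntegral.norm_integral_le_integral_norm_uIoc).trans ?_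
        have hsub : uIoc s t ⊆ Ioc 0 T := fun r hr => by
          have h3 := hr.1
          have h4 := hr.2
          exact ⟨(le_min hs.1 ht.1).trans_lt h3, h4.trans (max_le hs.2 ht.2)⟩
        have hIoc : ∀ {k : ℝ → ℝ}, Integrable k (timeMeasure T) → IntegrableOn k (Ioc 0 T) :=
          fun hk => by rwa [integrableOn_Ioc_iff_integrableOn_Ioo]
        calc ∫ r in uIoc s t, ‖2 * (inner ℝ η (u r) * w r η)‖
            ≤ ∫ r in Ioc 0 T, ‖2 * (inner ℝ η (u r) * w r η)‖ :=
              setIntegral_mono_set (hIoc (hxw.const_mul 2)).norm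
                (Filter.Eventually.of_forall fun _ => norm_nonneg _)
                (Filter.Eventually.of_forall hsub)
          _ ≤ ∫ r in Ioc 0 T, (inner ℝ η (u r) ^ 2 + w r η ^ 2) := by
              refine integral_mono (hIoc (hxw.const_mul 2)).norm (hIoc (hx2.add hw2)) fun r => ?_
              simp only [Real.norm_eq_abs]
              rw [abs_le]
              constructor <;> nlinarith [sq_nonneg (inner ℝ η (u r) - w r η),
                sq_nonneg (inner ℝ η (u r) + w r η)]
          _ = Q := integral_Ioc_eq_integral_Ioo
      linarith [hF3 s hs t ht]
    have hT' : (timeMeasure T).real univ = T := by simp [Measure.real, hT.le]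
    -- Averaging `hb` over `s ∈ (0, T)` replaces the unknown value `F s` by an integral, whence the
    -- constant `R² / T`.
    have hint : ∫ _, F t ^ 2 ∂(timeMeasure T)
        ≤ ∫ s, (R ^ 2 * inner ℝ η (u s) ^ 2 + Q) ∂(timeMeasure T) := by
      refine integral_mono_ae (integrable_const _)
        ((hx2.const_mul _).add (integrable_const _)) ?_
      filter_upwards [hF2, ae_restrict_mem measurableSet_Ioo] with s hs hsm
      have h1 := hb s (Ioo_subset_Icc_self hsm)
      rw [hs] at h1
      have h2 : l ^ 2 ≤ R ^ 2 := by gcongr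
      have h3 := mul_le_mul_of_nonneg_right h2 (sq_nonneg (inner ℝ η (u s)))
      change F t ^ 2 ≤ R ^ 2 * inner ℝ η (u s) ^ 2 + Q
      linarith [mul_pow l (inner ℝ η (u s)) 2]
    rw [integral_const, hT', integral_add (hx2.const_mul _) (integrable_const _),
      integral_const_mul, integral_const, hT', smul_eq_mul, smul_eq_mul] at hint
    rw [integral_add (hx2.const_mul _) hw2, integral_const_mul]
    rw [integral_add hx2 hw2] at hQ
    have : F t ^ 2 ≤ R ^ 2 / T * ∫ s, inner ℝ η (u s) ^ 2 ∂(timeMeasure T) + Q := by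
      rw [div_mul_eq_mul_div, ← sub_le_iff_le_add, le_div_iff₀ hT]
      linarith
    rw [hQ] at this
    linarith
  · rw [hF3 0 ⟨le_rfl, hT.le⟩ T ⟨hT.le, le_rfl⟩, integral_timeMeasure hT]

/-- `X ↪ C([0, T]; H)`, with the energy identity. -/
theorem exists_isContRep [CompleteSpace V] [TopologicalSpace.SeparableSpace V] [CompleteSpace H]
    {j : V →L[ℝ] H} (hj_inj : Function.Injective j) (hj_dense : DenseRange j)
    (hj_compact : IsCompactOperator j) {T : ℝ} (hT : 0 < T) (p : SpaceX j T) :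
    ∃ c, IsContRep j T p.1.1 c ∧
      (∀ t ∈ Icc 0 T, ‖c t‖ ^ 2 ≤ (‖j‖ ^ 2 / T + 1) * ‖p.1.1‖ ^ 2 + ‖p.1.2‖ ^ 2) ∧
      ‖c T‖ ^ 2 - ‖c 0‖ ^ 2 = 2 * opDt j T p p.1.1 := by
  obtain ⟨⟨u, w⟩, huw⟩ := p
  obtain ⟨ι, b, e, l, hl, hbe, hbi⟩ := exists_hilbertBasis_diagonal j hj_inj hj_dense hj_compact
  have hι : Countable ι := countable_of_orthonormal b.orthonormal
  have hlj : ∀ i, l i ≤ ‖j‖ := fun i => by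
    have h := j.le_opNorm (b i)
    rwa [hbe, norm_smul, e.orthonormal.1, b.orthonormal.1, mul_one, mul_one, Real.norm_eq_abs,
      abs_of_pos (hl i)] at h
  choose F hF1 hF2 hF3 hF4 using fun i =>
    exists_mode_rep hT huw (hl i) (hbe i) (hbi i) (hlj i)
  set K := ‖j‖ ^ 2 / T + 1 with hK
  have hK1 : 1 ≤ K := le_add_of_nonneg_left (by positivity)
  have hx2 : ∀ i, Integrable (fun t => inner ℝ (b i) (u t) ^ 2) (timeMeasure T) := fun i =>
    ((innerSL ℝ (b i)).comp_memLp' (Lp.memLp u)).integrable_sq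
  have hw2 : ∀ i, Integrable (fun t => w t (b i) ^ 2) (timeMeasure T) := fun i =>
    (memLp_right w (b i)).integrable_sq
  have hxw : ∀ i, Integrable (fun t => inner ℝ (b i) (u t) * w t (b i)) (timeMeasure T) :=
    fun i => MemLp.integrable_mul ((innerSL ℝ (b i)).comp_memLp' (Lp.memLp u))
      (memLp_right w (b i))
  -- The density that dominates mode `i` at every time; by Parseval, the sum over all modes is at
  -- most `K ‖u(t)‖² + ‖w(t)‖²`.
  let n : ι → ℝ → ℝ := fun i t => K * inner ℝ (b i) (u t) ^ 2 + w t (b i) ^ 2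
  have hn : ∀ i, Integrable (n i) (timeMeasure T) := fun i => ((hx2 i).const_mul K).add (hw2 i)
  let m : ι → ℝ := fun i => ∫ t, n i t ∂(timeMeasure T)
  have hm0 : ∀ i, 0 ≤ m i := fun i => integral_nonneg fun t => by simp only [n]; positivity
  have hms : ∀ s : Finset ι, ∑ i ∈ s, m i ≤ K * ‖u‖ ^ 2 + ‖w‖ ^ 2 := by
    intro s
    rw [← integral_finsetSum s fun i _ => hn i, norm_Lp_two_sq u, norm_Lp_two_sq w,
      ← integral_const_mul,
      ← integral_add ((integrable_norm_sq_Lp u).const_mul K) (integrable_norm_sq_Lp w)]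
    refine integral_mono (integrable_finsetSum s fun i _ => hn i)
      (((integrable_norm_sq_Lp u).const_mul K).add (integrable_norm_sq_Lp w)) fun t => ?_
    simp only [n]
    rw [Finset.sum_add_distrib, ← Finset.mul_sum]
    exact add_le_add (mul_le_mul_of_nonneg_left
      (sum_le_hasSum s (fun i _ => sq_nonneg _) (hasSum_inner_sq b (u t))) (by linarith))
      (sum_le_hasSum s (fun i _ => sq_nonneg _) (hasSum_dual_sq b (w t)))
  have hm : Summable m := summable_of_sum_le hm0 hms
  have hmt : ∑' i, m i ≤ K * ‖u‖ ^ 2 + ‖w‖ ^ 2 := Real.tsum_le_of_sum_le hm0 hms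
  have hmem : ∀ t ∈ Icc 0 T, Memℓp (fun i => F i t) 2 := fun t ht => by
    refine memℓp_gen ?_
    simp only [ENNReal.toReal_ofNat, Real.rpow_ofNat, Real.norm_eq_abs, sq_abs]
    exact Summable.of_nonneg_of_le (fun i => sq_nonneg _) (fun i => hF3 i t ht) hm
  have hex : ∀ t, ∃ x : H, t ∈ Icc 0 T → ∀ i, inner ℝ (e i) x = F i t := fun t => by
    by_cases ht : t ∈ Icc 0 T
    · refine ⟨e.repr.symm ⟨_, hmem t ht⟩, fun _ i => ?_⟩
      rw [← e.repr_apply_apply, LinearIsometryEquiv.apply_symm_apply]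
    · exact ⟨0, fun h => absurd h ht⟩
  choose c hc using hex
  have hcs : ∀ t ∈ Icc 0 T, HasSum (fun i => F i t ^ 2) (‖c t‖ ^ 2) := fun t ht => by
    simpa only [hc t ht] using hasSum_inner_sq e (c t)
  have h0 : (0 : ℝ) ∈ Icc 0 T := ⟨le_rfl, hT.le⟩
  have h1 : T ∈ Icc 0 T := ⟨hT.le, le_rfl⟩
  refine ⟨c, ⟨?_, ?_⟩, ?_, ?_⟩
  · intro s hs
    have hd : ∀ t ∈ Icc 0 T, ‖c t - c s‖ ^ 2 = ∑' i, (F i t - F i s) ^ 2 := fun t ht => by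
      rw [← (hasSum_inner_sq e (c t - c s)).tsum_eq]
      simp only [inner_sub_right, hc t ht, hc s hs]
    -- Dominated convergence over the modes: each term is at most `2 F i t² + 2 F i s² ≤ 4 m i`.
    have ht : Filter.Tendsto (fun t => ∑' i, (F i t - F i s) ^ 2) (nhdsWithin s (Icc 0 T))
        (nhds (∑' _ : ι, 0)) := by
      refine tendsto_tsum_of_dominated_convergence (hm.mul_left 4) (fun i => ?_) ?_
      · have := ((hF1 i s hs).sub_const (F i s)).pow 2
        simpa using this
      · filter_upwards [self_mem_nhdsWithin] with t ht i
        have h2 := hF3 i t ht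
        have h3 := hF3 i s hs
        rw [Real.norm_eq_abs, abs_of_nonneg (sq_nonneg _)]
        change F i t ^ 2 ≤ m i at h2
        change F i s ^ 2 ≤ m i at h3
        nlinarith [sq_nonneg (F i t + F i s)]
    rw [tsum_zero] at ht
    have ht2 : Filter.Tendsto (fun t => ‖c t - c s‖ ^ 2) (nhdsWithin s (Icc 0 T)) (nhds 0) :=
      ht.congr' (by filter_upwards [self_mem_nhdsWithin] with t ht using (hd t ht).symm)
    rw [ContinuousWithinAt, tendsto_iff_norm_sub_tendsto_zero]
    have := ht2.sqrt
    simpa [Real.sqrt_sq (norm_nonneg _)] using this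
  · filter_upwards [ae_all_iff.2 hF2, ae_restrict_mem measurableSet_Ioo] with t ht htm
    have htm' := Ioo_subset_Icc_self htm
    refine e.repr.injective (lp.ext (funext fun i => ?_))
    rw [e.repr_apply_apply, e.repr_apply_apply, hc t htm', ht i, real_inner_comm]
  · intro t ht
    refine le_trans ?_ hmt
    exact hasSum_le (fun i => hF3 i t ht) (hcs t ht) hm.hasSum
  · have hs1 := (hcs T h1).sub (hcs 0 h0)
    simp only [hF4] at hs1
    -- Sum and integral may be exchanged because `|2 x y| ≤ x² + y²` is below the density `n i`.
    have hs2 := hasSum_integral_of_summable_integral_norm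
      (F := fun i t => 2 * (inner ℝ (b i) (u t) * w t (b i))) (μ := timeMeasure T)
      (fun i => (hxw i).const_mul 2)
      (Summable.of_nonneg_of_le (fun i => integral_nonneg fun _ => norm_nonneg _) (fun i => by
        refine integral_mono ((hxw i).const_mul 2).norm (hn i) fun t => ?_
        simp only [n, Real.norm_eq_abs]
        have := mul_le_mul_of_nonneg_right hK1 (sq_nonneg (inner ℝ (b i) (u t)))
        rw [abs_le]
        constructor <;> nlinarith [sq_nonneg (inner ℝ (b i) (u t) - w t (b i)),
                sq_nonneg (inner ℝ (b i) (u t) + w t (b i))]) hm)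
    rw [hs1.unique hs2, opDt, ← integral_const_mul]
    refine integral_congr_ae (Filter.Eventually.of_forall fun t => ?_)
    exact ((hasSum_dual_mul_inner b (w t) (u t)).mul_left 2).tsum_eq

/-- The trace is the value of any continuous representative. -/
theorem IsContRep.trace_eq {j : V →L[ℝ] H} {T : ℝ} (hT : 0 < T) {p : SpaceX j T} {c : ℝ → H}
    (hc : IsContRep j T p.1.1 c) {t : ℝ} (ht : t ∈ Icc 0 T) : trace j T t p = c t := by
  have hex : ∃ c, IsContRep j T p.1.1 c := ⟨c, hc⟩
  rw [trace, dif_pos hex]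
  refine Measure.eqOn_Icc_of_ae_eq volume hT.ne ?_ hex.choose_spec.1 hc.1 ht
  rw [Measure.restrict_congr_set Ioo_ae_eq_Icc.symm]
  filter_upwards [hex.choose_spec.2, hc.2] with s h1 h2
  rw [h1, h2]

section Trace

variable [CompleteSpace V] [TopologicalSpace.SeparableSpace V] [CompleteSpace H]
  {j : V →L[ℝ] H}

theorem trace_add (hj_inj : Function.Injective j) (hj_dense : DenseRange j)
    (hj_compact : IsCompactOperator j) {T : ℝ} (hT : 0 < T) {t : ℝ} (ht : t ∈ Icc 0 T)
    (p q : SpaceX j T) : trace j T t (p + q) = trace j T t p + trace j T t q := by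
  obtain ⟨c, hc, -⟩ := exists_isContRep hj_inj hj_dense hj_compact hT p
  obtain ⟨d, hd, -⟩ := exists_isContRep hj_inj hj_dense hj_compact hT q
  have h : IsContRep j T (p + q).1.1 (fun t => c t + d t) := by
    refine ⟨hc.1.add hd.1, ?_⟩
    filter_upwards [hc.2, hd.2, Lp.coeFn_add p.1.1 q.1.1] with s h1 h2 h3
    have h4 : ((p + q).1.1 : ℝ → V) s = p.1.1 s + q.1.1 s := h3
    rw [h1, h2, h4, map_add]
  rw [hc.trace_eq hT ht, hd.trace_eq hT ht, h.trace_eq hT ht]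

theorem trace_smul (hj_inj : Function.Injective j) (hj_dense : DenseRange j)
    (hj_compact : IsCompactOperator j) {T : ℝ} (hT : 0 < T) {t : ℝ} (ht : t ∈ Icc 0 T)
    (r : ℝ) (p : SpaceX j T) : trace j T t (r • p) = r • trace j T t p := by
  obtain ⟨c, hc, -⟩ := exists_isContRep hj_inj hj_dense hj_compact hT p
  have h : IsContRep j T (r • p).1.1 (fun t => r • c t) := by
    refine ⟨hc.1.const_smul r, ?_⟩
    filter_upwards [hc.2, Lp.coeFn_smul r p.1.1] with s h1 h3
    have h4 : ((r • p).1.1 : ℝ → V) s = r • p.1.1 s := h3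
    rw [h1, h4, map_smul]
  rw [hc.trace_eq hT ht, h.trace_eq hT ht]

/-- The trace `γₜ` as a continuous linear map. -/
noncomputable def traceCLM (hj_inj : Function.Injective j) (hj_dense : DenseRange j)
    (hj_compact : IsCompactOperator j) {T : ℝ} (hT : 0 < T) {t : ℝ} (ht : t ∈ Icc 0 T) :
    SpaceX j T →L[ℝ] H :=
  LinearMap.mkContinuous
    { toFun := trace j T t
      map_add' := trace_add hj_inj hj_dense hj_compact hT ht
      map_smul' := trace_smul hj_inj hj_dense hj_compact hT ht } (√(‖j‖ ^ 2 / T + 2)) (by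
    intro p
    obtain ⟨c, hc, hb, -⟩ := exists_isContRep hj_inj hj_dense hj_compact hT p
    -- The norm of `X` is the maximum of the two component norms, so the constants `‖j‖² / T + 1`
    -- and `1` add up.
    have h1 : ‖p.1.1‖ ≤ ‖p‖ := le_max_left _ _
    have h2 : ‖p.1.2‖ ≤ ‖p‖ := le_max_right _ _
    change ‖trace j T t p‖ ≤ _
    rw [hc.trace_eq hT ht, ← Real.sqrt_sq (norm_nonneg p), ← Real.sqrt_mul (by positivity)]
    refine Real.le_sqrt_of_sq_le ((hb t ht).trans ?_)
    calc (‖j‖ ^ 2 / T + 1) * ‖p.1.1‖ ^ 2 + ‖p.1.2‖ ^ 2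
        ≤ (‖j‖ ^ 2 / T + 1) * ‖p‖ ^ 2 + ‖p‖ ^ 2 := by gcongr
      _ = _ := by ring)

theorem two_mul_opDt_self (hj_inj : Function.Injective j) (hj_dense : DenseRange j)
    (hj_compact : IsCompactOperator j) {T : ℝ} (hT : 0 < T) (p : SpaceX j T) :
    2 * opDt j T p p.1.1 = ‖trace j T T p‖ ^ 2 - ‖trace j T 0 p‖ ^ 2 := by
  obtain ⟨c, hc, -, he⟩ := exists_isContRep hj_inj hj_dense hj_compact hT p
  rw [hc.trace_eq hT ⟨hT.le, le_rfl⟩, hc.trace_eq hT ⟨le_rfl, hT.le⟩, he]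

end Trace

end TraceEmbedding

/-! ### The energy space. -/

/-- A positive definite symmetric bilinear form is the inner product of an isomorphic space. -/
theorem exists_innerProductSpace_of_form.{u} {E : Type u} [AddCommGroup E] [Module ℝ E]
    (A : E → E → ℝ) (hsymm : ∀ x y, A x y = A y x)
    (hadd : ∀ x y z, A (x + y) z = A x z + A y z) (hsmul : ∀ (r : ℝ) x y, A (r • x) y = r * A x y)
    (hnonneg : ∀ x, 0 ≤ A x x) (hdef : ∀ x, A x x = 0 → x = 0) :
    ∃ (Z : Type u) (_ : NormedAddCommGroup Z) (_ : InnerProductSpace ℝ Z) (e : E ≃ₗ[ℝ] Z),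
      ∀ x y, inner ℝ (e x) (e y) = A x y := by
  -- The new space is `E` itself; hiding it behind an isomorphism keeps its norm apart from a given
  -- one.
  let core : InnerProductSpace.Core ℝ E :=
    { inner := A
      conj_inner_symm := fun x y => by simp [hsymm x y]
      re_inner_nonneg := fun x => by simpa using hnonneg x
      add_left := hadd
      smul_left := fun x y r => by simpa using hsmul r x y
      definite := hdef }
  exact ⟨E, core.toNormedAddCommGroup, InnerProductSpace.ofCore core.toCore,
    LinearEquiv.refl ℝ E, fun _ _ => rfl⟩

/-- A bounded coercive symmetric bilinear form on a Banach space is the inner product of an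
isomorphic Hilbert space. -/
theorem exists_energySpace.{u} {E : Type u} [NormedAddCommGroup E] [NormedSpace ℝ E]
    [CompleteSpace E] (A : E → E → ℝ) (hsymm : ∀ x y, A x y = A y x)
    (hadd : ∀ x y z, A (x + y) z = A x z + A y z) (hsmul : ∀ (r : ℝ) x y, A (r • x) y = r * A x y)
    {C α : ℝ} (hα : 0 < α) (hbdd : ∀ x, A x x ≤ C * ‖x‖ ^ 2) (hcoer : ∀ x, α * ‖x‖ ^ 2 ≤ A x x) :
    ∃ (Z : Type u) (_ : NormedAddCommGroup Z) (_ : InnerProductSpace ℝ Z) (_ : CompleteSpace Z)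
      (e : E ≃L[ℝ] Z), ∀ x y, inner ℝ (e x) (e y) = A x y := by
  obtain ⟨Z, i1, i2, e, he⟩ := exists_innerProductSpace_of_form A hsymm hadd hsmul
    (fun x => (by positivity : 0 ≤ α * ‖x‖ ^ 2).trans (hcoer x)) (fun x hx => by
      have h := hcoer x
      rw [hx] at h
      have h2 : ‖x‖ ^ 2 ≤ 0 := by
        by_contra hc
        exact absurd h (not_le.2 (mul_pos hα (not_le.1 hc)))
      exact norm_eq_zero.1 (pow_eq_zero_iff two_ne_zero |>.1 (le_antisymm h2 (sq_nonneg _))))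
  have hn : ∀ x, ‖e x‖ ^ 2 = A x x := fun x => by rw [← real_inner_self_eq_norm_sq, he]
  -- Coercivity and boundedness say that the two norms are equivalent. The maximum with 0 covers a
  -- negative `C`, possible when `E` is trivial.
  let e' : E ≃L[ℝ] Z := e.toContinuousLinearEquivOfBounds √(max C 0) (√α)⁻¹
    (fun x => by
      refine le_of_sq_le_sq ?_ (by positivity)
      rw [hn, mul_pow, Real.sq_sqrt (le_max_right _ _)]
      exact (hbdd x).trans (mul_le_mul_of_nonneg_right (le_max_left _ _) (sq_nonneg _)))
    (fun z => by
      obtain ⟨x, rfl⟩ := e.surjective z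
      rw [e.symm_apply_apply]
      have hs : 0 < √α := Real.sqrt_pos.2 hα
      rw [inv_mul_eq_div, le_div_iff₀ hs]
      refine le_of_sq_le_sq ?_ (norm_nonneg _)
      rw [hn, mul_pow, Real.sq_sqrt hα.le, mul_comm]
      exact hcoer x)
  exact ⟨Z, i1, i2, (completeSpace_congr (e := e'.toEquiv) e'.isUniformEmbedding).1 inferInstance,
    e', he⟩

/-! ### The form and the duality pairing on `L₂(I; V)`, and closedness of `X`. -/

section Forms

variable {V H : Type*} [NormedAddCommGroup V] [InnerProductSpace ℝ V]
  [NormedAddCommGroup H] [InnerProductSpace ℝ H]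

section Form

variable {T : ℝ} {a : ℝ → V →ₗ[ℝ] V →ₗ[ℝ] ℝ}

/-- Measurability is given for fixed arguments only. Expanding `u t`, then `v t`, in a countable
Hilbert basis gives measurable partial sums, which converge since `a t` is bounded for a.e. `t`. -/
theorem aemeasurable_form [CompleteSpace V] [TopologicalSpace.SeparableSpace V]
    (ha_meas : ∀ η ζ : V, AEMeasurable (fun t => a t η ζ) (timeMeasure T))
    {M : ℝ} (hM : ∀ᵐ t ∂(timeMeasure T), ∀ η ζ : V, |a t η ζ| ≤ M * ‖η‖ * ‖ζ‖)
    (u v : SpaceY V T) : AEMeasurable (fun t => a t (u t) (v t)) (timeMeasure T) := by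
  obtain ⟨s, b, -⟩ := exists_hilbertBasis ℝ V
  have hι : Countable s := countable_of_orthonormal b.orthonormal
  have hx : ∀ (w : SpaceY V T) i, AEMeasurable (fun t => inner ℝ (b i) (w t)) (timeMeasure T) :=
    fun w i => ((innerSL ℝ (b i)).comp_memLp' (Lp.memLp w)).1.aemeasurable
  have h1 : ∀ ζ, AEMeasurable (fun t => a t (u t) ζ) (timeMeasure T) := by
    intro ζ
    refine aemeasurable_of_tendsto_metrizable_ae (Filter.atTop : Filter (Finset s))
      (f := fun F t => ∑ i ∈ F, inner ℝ (b i) (u t) * a t (b i) ζ)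
      (fun F => Finset.aemeasurable_fun_sum F fun i _ => (hx u i).mul (ha_meas (b i) ζ)) ?_
    filter_upwards [hM] with t ht
    let L : V →L[ℝ] ℝ := LinearMap.mkContinuous ((a t).flip ζ) (M * ‖ζ‖) fun η => by
      rw [mul_right_comm]; exact ht η ζ
    exact (hasSum_dual_mul_inner b L (u t))
  refine aemeasurable_of_tendsto_metrizable_ae (Filter.atTop : Filter (Finset s))
    (f := fun F t => ∑ i ∈ F, inner ℝ (b i) (v t) * a t (u t) (b i))
    (fun F => Finset.aemeasurable_fun_sum F fun i _ => (hx v i).mul (h1 (b i))) ?_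
  filter_upwards [hM] with t ht
  let L : V →L[ℝ] ℝ := LinearMap.mkContinuous (a t (u t)) (M * ‖u t‖) fun η => ht (u t) η
  exact (hasSum_dual_mul_inner b L (v t))

theorem integrable_form [CompleteSpace V] [TopologicalSpace.SeparableSpace V]
    (ha_meas : ∀ η ζ : V, AEMeasurable (fun t => a t η ζ) (timeMeasure T))
    {M : ℝ} (hM : ∀ᵐ t ∂(timeMeasure T), ∀ η ζ : V, |a t η ζ| ≤ M * ‖η‖ * ‖ζ‖)
    (u v : SpaceY V T) : Integrable (fun t => a t (u t) (v t)) (timeMeasure T) := by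
  have h : Integrable (fun t => M * (‖u t‖ * ‖v t‖)) (timeMeasure T) :=
    ((Lp.memLp u).norm.integrable_mul (Lp.memLp v).norm).const_mul M
  refine h.mono' (aemeasurable_form ha_meas hM u v).aestronglyMeasurable ?_
  filter_upwards [hM] with t ht
  rw [← mul_assoc]
  exact ht _ _

theorem opA_add_left [CompleteSpace V] [TopologicalSpace.SeparableSpace V]
    (ha_meas : ∀ η ζ : V, AEMeasurable (fun t => a t η ζ) (timeMeasure T))
    {M : ℝ} (hM : ∀ᵐ t ∂(timeMeasure T), ∀ η ζ : V, |a t η ζ| ≤ M * ‖η‖ * ‖ζ‖)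
    (u v w : SpaceY V T) : opA a T (u + v) w = opA a T u w + opA a T v w := by
  rw [opA, opA, opA, ← integral_add (integrable_form ha_meas hM u w)
    (integrable_form ha_meas hM v w)]
  refine integral_congr_ae ?_
  filter_upwards [Lp.coeFn_add u v] with t ht
  rw [ht, Pi.add_apply, map_add, LinearMap.add_apply]

theorem opA_smul_left (r : ℝ) (u w : SpaceY V T) : opA a T (r • u) w = r * opA a T u w := by
  rw [opA, opA, ← integral_const_mul]
  refine integral_congr_ae ?_
  filter_upwards [Lp.coeFn_smul r u] with t ht
  rw [ht, Pi.smul_apply, map_smul, LinearMap.smul_apply, smul_eq_mul]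

theorem opA_self_le [CompleteSpace V] [TopologicalSpace.SeparableSpace V]
    (ha_meas : ∀ η ζ : V, AEMeasurable (fun t => a t η ζ) (timeMeasure T))
    {M : ℝ} (hM : ∀ᵐ t ∂(timeMeasure T), ∀ η ζ : V, |a t η ζ| ≤ M * ‖η‖ * ‖ζ‖)
    (u : SpaceY V T) : opA a T u u ≤ M * ‖u‖ ^ 2 := by
  rw [norm_Lp_two_sq, ← integral_const_mul]
  refine integral_mono_ae (integrable_form ha_meas hM u u)
    ((integrable_norm_sq_Lp u).const_mul M) ?_
  filter_upwards [hM] with t ht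
  have := (le_abs_self _).trans (ht (u t) (u t))
  rwa [mul_assoc, ← sq] at this

theorem le_opA_self [CompleteSpace V] [TopologicalSpace.SeparableSpace V]
    (ha_meas : ∀ η ζ : V, AEMeasurable (fun t => a t η ζ) (timeMeasure T))
    {M : ℝ} (hM : ∀ᵐ t ∂(timeMeasure T), ∀ η ζ : V, |a t η ζ| ≤ M * ‖η‖ * ‖ζ‖)
    {α : ℝ} (hα : ∀ᵐ t ∂(timeMeasure T), ∀ η : V, α * ‖η‖ ^ 2 ≤ a t η η)
    (u : SpaceY V T) : α * ‖u‖ ^ 2 ≤ opA a T u u := by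
  rw [norm_Lp_two_sq, ← integral_const_mul]
  refine integral_mono_ae ((integrable_norm_sq_Lp u).const_mul α)
    (integrable_form ha_meas hM u u) ?_
  filter_upwards [hα] with t ht using ht (u t)

end Form

/-- The duality pairing of `L₂(I; V')` and `L₂(I; V)`. -/
noncomputable def pairing (V : Type*) [NormedAddCommGroup V] [InnerProductSpace ℝ V] (T : ℝ) :
    SpaceL2Dual V T →L[ℝ] SpaceY V T →L[ℝ] ℝ :=
  (ContinuousLinearMap.id ℝ (StrongDual ℝ V)).lpPairing (timeMeasure T) 2 2

theorem pairing_apply {T : ℝ} (w : SpaceL2Dual V T) (v : SpaceY V T) :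
    pairing V T w v = ∫ t, w t (v t) ∂(timeMeasure T) := by
  rw [pairing, ContinuousLinearMap.lpPairing_eq_integral]
  rfl

theorem integrable_pairing {T : ℝ} (w : SpaceL2Dual V T) (v : SpaceY V T) :
    Integrable (fun t => w t (v t)) (timeMeasure T) := by
  have h : Integrable (fun t => ‖w t‖ * ‖v t‖) (timeMeasure T) :=
    (Lp.memLp w).norm.integrable_mul (Lp.memLp v).norm
  refine h.mono' ?_ (Filter.Eventually.of_forall fun t => (w t).le_opNorm (v t))
  exact (ContinuousLinearMap.id ℝ (StrongDual ℝ V)).aestronglyMeasurable_comp₂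
    (Lp.memLp w).1 (Lp.memLp v).1

/-- `L₂(I; V')` is isometric to its image in the dual of `L₂(I; V)`: the norm is attained. -/
theorem exists_pairing_eq_norm_sq [CompleteSpace V] {T : ℝ} (w : SpaceL2Dual V T) :
    ∃ v : SpaceY V T, ‖v‖ = ‖w‖ ∧ pairing V T w v = ‖w‖ ^ 2 := by
  -- The pointwise Riesz representative of `w` attains the norm.
  let R : StrongDual ℝ V →L[ℝ] V := LinearMap.mkContinuous
    { toFun := (InnerProductSpace.toDual ℝ V).symm
      map_add' := map_add _
      map_smul' := fun r f => by simp } 1 (fun f => by simp)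
  have hR : ∀ f, ‖R f‖ = ‖f‖ := fun f => LinearIsometryEquiv.norm_map _ f
  have hR2 : ∀ f : StrongDual ℝ V, f (R f) = ‖f‖ ^ 2 := fun f => by
    rw [← hR, ← real_inner_self_eq_norm_sq]
    exact InnerProductSpace.toDual_symm_apply.symm
  have hv := R.coeFn_compLp w
  refine ⟨R.compLp w, ?_, ?_⟩
  · rw [← sq_eq_sq₀ (norm_nonneg _) (norm_nonneg _), norm_Lp_two_sq, norm_Lp_two_sq]
    refine integral_congr_ae ?_
    filter_upwards [hv] with t ht
    rw [ht, hR]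
  · rw [pairing_apply, norm_Lp_two_sq]
    refine integral_congr_ae ?_
    filter_upwards [hv] with t ht
    rw [ht, hR2]

/-- For a fixed test function and `η`, both sides of the weak derivative identity are continuous
functionals. This makes `X` complete, as the closed range argument requires. -/
theorem isClosed_spaceX (j : V →L[ℝ] H) (T : ℝ) :
    IsClosed (SpaceX j T : Set (SpaceY V T × SpaceL2Dual V T)) := by
  have hset : (SpaceX j T : Set (SpaceY V T × SpaceL2Dual V T)) =
      ⋂ (φ : ℝ → ℝ) (_ : IsTestFun T φ) (η : V), {p | ∫ t, deriv φ t *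
        inner ℝ (j (p.1 t)) (j η) ∂(timeMeasure T) = -∫ t, φ t * p.2 t η ∂(timeMeasure T)} := by
    ext p
    simp only [mem_iInter]
    rfl
  rw [hset]
  refine isClosed_iInter fun φ => isClosed_iInter fun hφ => isClosed_iInter fun η => ?_
  have hc : MemLp φ 2 (timeMeasure T) := hφ.1.continuous.memLp_of_hasCompactSupport hφ.2.1
  have hc' : MemLp (deriv φ) 2 (timeMeasure T) :=
    (hφ.1.continuous_deriv (by simp)).memLp_of_hasCompactSupport hφ.2.1.deriv
  let L1 : SpaceY V T →L[ℝ] ℝ :=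
    (((ContinuousLinearMap.id ℝ ℝ).smulRight ((innerSL ℝ (j η)).comp j)).lpPairing
      (timeMeasure T) 2 2) hc'.toLp
  let L2 : SpaceL2Dual V T →L[ℝ] ℝ :=
    (((ContinuousLinearMap.id ℝ ℝ).smulRight (ContinuousLinearMap.apply ℝ ℝ η)).lpPairing
      (timeMeasure T) 2 2) hc.toLp
  have h1 : ∀ u : SpaceY V T,
      ∫ t, deriv φ t * inner ℝ (j (u t)) (j η) ∂(timeMeasure T) = L1 u := fun u => by
    rw [ContinuousLinearMap.lpPairing_eq_integral]
    refine integral_congr_ae ?_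
    filter_upwards [hc'.coeFn_toLp] with t ht
    simp [ht, real_inner_comm]
  have h2 : ∀ w : SpaceL2Dual V T, ∫ t, φ t * w t η ∂(timeMeasure T) = L2 w := fun w => by
    rw [ContinuousLinearMap.lpPairing_eq_integral]
    refine integral_congr_ae ?_
    filter_upwards [hc.coeFn_toLp] with t ht
    simp [ht]
  simp only [h1, h2]
  exact isClosed_eq (L1.continuous.comp continuous_fst) (L2.continuous.comp continuous_snd).neg

/-- The weak time derivative is determined by the function. -/
theorem spaceX_ext [TopologicalSpace.SeparableSpace V] {j : V →L[ℝ] H} {T : ℝ}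
    {p q : SpaceX j T} (h : p.1.1 = q.1.1) : p = q := by
  have key : ∀ r : SpaceX j T, r.1.1 = 0 → r = 0 := by
    rintro ⟨⟨u, w⟩, hr⟩ (rfl : u = 0)
    have hw : ∀ η : V, ∀ᵐ t ∂(timeMeasure T), w t η = 0 := by
      intro η
      rw [ae_restrict_iff' measurableSet_Ioo]
      refine isOpen_Ioo.ae_eq_zero_of_integral_contDiff_smul_eq_zero
        (IntegrableOn.locallyIntegrableOn ((memLp_right w η).integrable (by norm_num))) ?_
      intro φ h1 h2 h3
      have hφ : IsTestFun T φ := ⟨h1, h2, h3⟩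
      have e1 := hr φ hφ η
      have e2 : ∫ t, deriv φ t * inner ℝ (j ((0 : SpaceY V T) t)) (j η) ∂(timeMeasure T) = 0 := by
        rw [← integral_zero ℝ ℝ (μ := timeMeasure T)]
        refine integral_congr_ae ?_
        filter_upwards [Lp.coeFn_zero V 2 (timeMeasure T)] with t ht
        rw [ht]; simp
      rw [← setIntegral_eq_integral_of_forall_compl_eq_zero (s := Ioo 0 T)]
      · change ∫ t, φ t * w t η ∂(timeMeasure T) = 0
        dsimp only at e1
        linarith
      · intro t ht
        rw [hφ.eq_zero ht, zero_smul]
    have hw0 : w = 0 := by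
      refine Lp.ext ?_
      -- The null set depends on `η`; a countable dense sequence suffices because `w t` is
      -- continuous.
      filter_upwards [ae_all_iff.2 fun n => hw (TopologicalSpace.denseSeq V n),
        Lp.coeFn_zero (StrongDual ℝ V) 2 (timeMeasure T)] with t ht h0
      rw [h0]
      refine ContinuousLinearMap.ext fun η => ?_
      exact congrFun ((TopologicalSpace.denseRange_denseSeq V).equalizer (w t).continuous
        continuous_const (funext ht)) η
    subst hw0
    rfl
  rw [← sub_eq_zero]
  exact key _ (sub_eq_zero.2 h)

end Forms

/-! ### The abstract saddle point problem in the energy space. -/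

section Galerkin

variable {X Z H : Type*} [AddCommGroup X] [Module ℝ X]
  [NormedAddCommGroup Z] [InnerProductSpace ℝ Z]
  [NormedAddCommGroup H] [InnerProductSpace ℝ H]

/-- The map `u ↦ (c u, P (D u), γ u)` into the `ℓ²`-product, whose norm is the graph norm. -/
noncomputable def graphMap (c D : X →ₗ[ℝ] Z) (γ : X →ₗ[ℝ] H) (P : Z →L[ℝ] Z) :
    X →ₗ[ℝ] WithLp 2 (Z × WithLp 2 (Z × H)) where
  toFun u := WithLp.toLp 2 (c u, WithLp.toLp 2 (P (D u), γ u))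
  map_add' u v := by simp only [map_add]; rfl
  map_smul' r u := by simp only [map_smul]; rfl

theorem norm_graphMap_sq (c D : X →ₗ[ℝ] Z) (γ : X →ₗ[ℝ] H) (P : Z →L[ℝ] Z) (u : X) :
    ‖graphMap c D γ P u‖ ^ 2 = ‖c u‖ ^ 2 + ‖P (D u)‖ ^ 2 + ‖γ u‖ ^ 2 := by
  simp [graphMap, WithLp.prod_norm_sq_eq_of_L2, add_assoc]

/-- The energy identity turns the norm of `(P (B u), u(0))` into the graph norm. -/
theorem norm_residual_sq {c D : X →ₗ[ℝ] Z} {γ₀ γ : X →ₗ[ℝ] H} {K : Submodule ℝ Z}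
    [K.HasOrthogonalProjection]
    (henergy : ∀ u, 2 * inner ℝ (D u) (c u) = ‖γ u‖ ^ 2 - ‖γ₀ u‖ ^ 2) {u : X} (hu : c u ∈ K) :
    ‖K.starProjection (D u + c u)‖ ^ 2 + ‖γ₀ u‖ ^ 2
      = ‖graphMap c D γ K.starProjection u‖ ^ 2 := by
  -- This is where `Xδ ⊆ Yδ` enters: the projection fixes `c u`, hence keeps the cross term of the
  -- square.
  have h1 : K.starProjection (c u) = c u := Submodule.starProjection_eq_self_iff.2 hu
  have h2 : inner ℝ (K.starProjection (D u)) (c u) = inner ℝ (D u) (c u) := by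
    rw [Submodule.inner_starProjection_left_eq_right, h1]
  rw [norm_graphMap_sq, map_add, h1, norm_add_sq_real, h2]
  linarith [henergy u]

theorem norm_residual_sq_top {c D : X →ₗ[ℝ] Z} {γ₀ γ : X →ₗ[ℝ] H}
    (henergy : ∀ u, 2 * inner ℝ (D u) (c u) = ‖γ u‖ ^ 2 - ‖γ₀ u‖ ^ 2) (u : X) :
    ‖D u + c u‖ ^ 2 + ‖γ₀ u‖ ^ 2 = ‖graphMap c D γ (ContinuousLinearMap.id ℝ Z) u‖ ^ 2 := by
  rw [norm_graphMap_sq, norm_add_sq_real, ContinuousLinearMap.id_apply]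
  linarith [henergy u]

theorem norm_graphMap_le (c D : X →ₗ[ℝ] Z) (γ : X →ₗ[ℝ] H) (K : Submodule ℝ Z)
    [K.HasOrthogonalProjection] (u : X) :
    ‖graphMap c D γ K.starProjection u‖
      ≤ ‖graphMap c D γ (ContinuousLinearMap.id ℝ Z) u‖ := by
  refine le_of_sq_le_sq ?_ (norm_nonneg _)
  rw [norm_graphMap_sq, norm_graphMap_sq]
  have := K.norm_starProjection_apply_le (D u)
  simp only [ContinuousLinearMap.id_apply]
  gcongr

/-- The saddle point system, with the operators represented in the energy space. -/
def IsSaddlePoint (c D : X →ₗ[ℝ] Z) (γ₀ : X →ₗ[ℝ] H) (K : Submodule ℝ Z) (Hd : Submodule ℝ H)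
    (Xd : Submodule ℝ X) (g : Z) (u₀ : H) (μ : Z) (σ : H) (u : X) : Prop :=
  (∀ v ∈ K, inner ℝ μ v + inner ℝ (D u + c u) v = inner ℝ g v) ∧
  (∀ h ∈ Hd, inner ℝ σ h + inner ℝ (γ₀ u) h = inner ℝ u₀ h) ∧
  (∀ w ∈ Xd, inner ℝ (D w + c w) μ + inner ℝ (γ₀ w) σ = 0)

/-- Testing the difference of two solutions with its own `μ` and `σ` makes the `B` terms cancel by
the third equation, so both vanish. Testing next with `c u` and `γ₀ u` gives `γ₀ u = 0` and `⟨D u, c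
u⟩ + ‖c u‖² = 0`, where the inner product is nonnegative by the energy identity. No closedness is
involved. -/
theorem IsSaddlePoint.unique {c D : X →ₗ[ℝ] Z} {γ₀ γ : X →ₗ[ℝ] H} {K : Submodule ℝ Z}
    {Hd : Submodule ℝ H} {Xd : Submodule ℝ X} {g : Z} {u₀ : H}
    (henergy : ∀ u, 2 * inner ℝ (D u) (c u) = ‖γ u‖ ^ 2 - ‖γ₀ u‖ ^ 2)
    (hc : Function.Injective c)
    (hXK : ∀ u ∈ Xd, c u ∈ K) (hXH : ∀ u ∈ Xd, γ₀ u ∈ Hd)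
    {μ μ' : Z} {σ σ' : H} {u u' : X} (hμ : μ ∈ K) (hμ' : μ' ∈ K) (hσ : σ ∈ Hd) (hσ' : σ' ∈ Hd)
    (hu : u ∈ Xd) (hu' : u' ∈ Xd)
    (h : IsSaddlePoint c D γ₀ K Hd Xd g u₀ μ σ u)
    (h' : IsSaddlePoint c D γ₀ K Hd Xd g u₀ μ' σ' u') : μ = μ' ∧ σ = σ' ∧ u = u' := by
  have e1 : ∀ v ∈ K, inner ℝ (μ - μ') v + inner ℝ (D (u - u') + c (u - u')) v = 0 := by
    intro v hv
    have a := h.1 v hv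
    have b := h'.1 v hv
    simp only [map_sub, inner_add_left, inner_sub_left] at a b ⊢
    linarith
  have e2 : ∀ k ∈ Hd, inner ℝ (σ - σ') k + inner ℝ (γ₀ (u - u')) k = 0 := by
    intro k hk
    have a := h.2.1 k hk
    have b := h'.2.1 k hk
    simp only [map_sub, inner_sub_left] at a b ⊢
    linarith
  have e3 : inner ℝ (D (u - u') + c (u - u')) (μ - μ') + inner ℝ (γ₀ (u - u')) (σ - σ') = 0 := by
    have a := h.2.2 _ (sub_mem hu hu')
    have b := h'.2.2 _ (sub_mem hu hu')
    rw [inner_sub_right, inner_sub_right]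
    linarith
  have hd := sub_mem hu hu'
  have f1 := e1 _ (sub_mem hμ hμ')
  have f2 := e2 _ (sub_mem hσ hσ')
  rw [real_inner_self_eq_norm_sq] at f1 f2
  have z1 : μ - μ' = 0 := by
    rw [← norm_eq_zero, ← sq_eq_zero_iff]; nlinarith [sq_nonneg ‖μ - μ'‖, sq_nonneg ‖σ - σ'‖]
  have z2 : σ - σ' = 0 := by
    rw [← norm_eq_zero, ← sq_eq_zero_iff]; nlinarith [sq_nonneg ‖μ - μ'‖, sq_nonneg ‖σ - σ'‖]
  have f3 := e1 _ (hXK _ hd)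
  have f4 := e2 _ (hXH _ hd)
  rw [z1, inner_zero_left, zero_add, inner_add_left, real_inner_self_eq_norm_sq] at f3
  rw [z2, inner_zero_left, zero_add, real_inner_self_eq_norm_sq] at f4
  have z3 : c (u - u') = 0 := by
    rw [← norm_eq_zero, ← sq_eq_zero_iff]
    nlinarith [henergy (u - u'), sq_nonneg ‖γ (u - u')‖, sq_nonneg ‖c (u - u')‖]
  exact ⟨sub_eq_zero.1 z1, sub_eq_zero.1 z2, hc (by simpa [sub_eq_zero] using z3)⟩

/-- The least-squares map `u ↦ (P (B u), u(0))`. -/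
noncomputable def residualMap (c D : X →ₗ[ℝ] Z) (γ₀ : X →ₗ[ℝ] H) (P : Z →L[ℝ] Z) :
    X →ₗ[ℝ] WithLp 2 (Z × H) where
  toFun u := WithLp.toLp 2 (P (D u + c u), γ₀ u)
  map_add' u v := by
    rw [map_add D, map_add c, map_add γ₀, add_add_add_comm, map_add P]
    rfl
  map_smul' r u := by
    rw [map_smul D, map_smul c, map_smul γ₀, ← smul_add, map_smul P]
    rfl

/-- A least-squares solution exists because the range is closed: `u` is a preimage of the projection
of `(P g, u₀)`, the multipliers are the projected residuals, and the third equation says that the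
residual is orthogonal to the range. -/
theorem exists_isSaddlePoint [CompleteSpace Z] [CompleteSpace H]
    {c D : X →ₗ[ℝ] Z} {γ₀ : X →ₗ[ℝ] H} {K : Submodule ℝ Z}
    [K.HasOrthogonalProjection] {Hd : Submodule ℝ H} [Hd.HasOrthogonalProjection]
    {Xd : Submodule ℝ X} (hXH : ∀ u ∈ Xd, γ₀ u ∈ Hd)
    (hcl : IsClosed (Xd.map (residualMap c D γ₀ K.starProjection) : Set (WithLp 2 (Z × H))))
    (g : Z) (u₀ : H) :
    ∃ μ ∈ K, ∃ σ ∈ Hd, ∃ u ∈ Xd, IsSaddlePoint c D γ₀ K Hd Xd g u₀ μ σ u := by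
  set R := Xd.map (residualMap c D γ₀ K.starProjection) with hR
  have : CompleteSpace R := hcl.completeSpace_coe
  obtain ⟨u, hu, hur⟩ := Submodule.mem_map.1
    (R.starProjection_apply_mem (WithLp.toLp 2 (K.starProjection g, u₀)))
  refine ⟨K.starProjection (g - (D u + c u)), Submodule.starProjection_apply_mem _ _,
    Hd.starProjection (u₀ - γ₀ u), Submodule.starProjection_apply_mem _ _, u, hu, ?_, ?_, ?_⟩
  · intro v hv
    rw [Submodule.inner_starProjection_left_eq_right, Submodule.starProjection_eq_self_iff.2 hv,
      inner_sub_left]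
    ring
  · intro v hv
    rw [Submodule.inner_starProjection_left_eq_right, Submodule.starProjection_eq_self_iff.2 hv,
      inner_sub_left]
    ring
  · intro w hw
    have h1 := R.starProjection_inner_eq_zero (WithLp.toLp 2 (K.starProjection g, u₀))
      (residualMap c D γ₀ K.starProjection w) (Submodule.mem_map_of_mem hw)
    rw [← hur, WithLp.prod_inner_apply] at h1
    simp only [residualMap, LinearMap.coe_mk, AddHom.coe_mk, WithLp.ofLp_sub, Prod.fst_sub,
      Prod.snd_sub, ← map_sub] at h1
    rw [← Submodule.inner_starProjection_left_eq_right,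
      Submodule.starProjection_eq_self_iff.2 (Submodule.starProjection_apply_mem _ _)] at h1
    -- The projection onto `Hd` is invisible to `γ₀ w ∈ Hd`.
    have h2 : inner ℝ (γ₀ w) (Hd.starProjection (u₀ - γ₀ u)) = inner ℝ (γ₀ w) (u₀ - γ₀ u) := by
      rw [← Submodule.inner_starProjection_left_eq_right,
        Submodule.starProjection_eq_self_iff.2 (hXH w hw)]
    rw [h2, real_inner_comm, real_inner_comm (u₀ - γ₀ u)]
    exact h1

/-- The first equation identifies `μ` with `P B (u - ud)`, and against `γ₀ z` with `z ∈ Xd` the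
multiplier `σ` acts as `γ₀ (u - ud)`; the third equation thus becomes Galerkin orthogonality. -/
theorem IsSaddlePoint.error_le {c D : X →ₗ[ℝ] Z} {γ₀ γ : X →ₗ[ℝ] H} {K : Submodule ℝ Z}
    [K.HasOrthogonalProjection] {Hd : Submodule ℝ H} {Xd : Submodule ℝ X} {g : Z} {u₀ : H}
    (henergy : ∀ u, 2 * inner ℝ (D u) (c u) = ‖γ u‖ ^ 2 - ‖γ₀ u‖ ^ 2)
    (hXK : ∀ u ∈ Xd, c u ∈ K) (hXH : ∀ u ∈ Xd, γ₀ u ∈ Hd)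
    {μ : Z} {σ : H} {ud u : X} (hμ : μ ∈ K) (hud : ud ∈ Xd)
    (h : IsSaddlePoint c D γ₀ K Hd Xd g u₀ μ σ ud)
    (hB : D u + c u = g) (h0 : γ₀ u = u₀) {w : X} (hw : w ∈ Xd) :
    ‖graphMap c D γ K.starProjection (u - ud)‖
      ≤ 2 * ‖graphMap c D γ (ContinuousLinearMap.id ℝ Z) (u - w)‖ := by
  set N := graphMap c D γ K.starProjection
  set N' := graphMap c D γ (ContinuousLinearMap.id ℝ Z)
  have orth : ∀ z ∈ Xd, inner ℝ (K.starProjection (D (u - ud) + c (u - ud))) (D z + c z)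
      + inner ℝ (γ₀ (u - ud)) (γ₀ z) = 0 := by
    intro z hz
    have e1 : inner ℝ (K.starProjection (D (u - ud) + c (u - ud))) (D z + c z)
        = inner ℝ μ (D z + c z) := by
      have hk := h.1 _ (K.starProjection_apply_mem (D z + c z))
      rw [← Submodule.inner_starProjection_left_eq_right,
        Submodule.starProjection_eq_self_iff.2 hμ] at hk
      rw [Submodule.inner_starProjection_left_eq_right, map_sub, map_sub, sub_add_sub_comm, hB,
        inner_sub_left]
      linarith
    have e2 := h.2.1 _ (hXH z hz)
    have e3 := h.2.2 z hz
    rw [e1, map_sub, h0, inner_sub_left]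
    rw [real_inner_comm, real_inner_comm σ] at e3
    linarith
  have hdz : ud - w ∈ Xd := sub_mem hud hw
  -- With `z = ud - w`, orthogonality gives `‖P B z‖² + ‖γ₀ z‖² = ⟨B (u - w), P B z⟩ + ⟨γ₀ (u - w),
  -- γ₀ z⟩`; Cauchy-Schwarz and the two residual identities conclude.
  have key : ‖N (ud - w)‖ ≤ ‖N' (u - w)‖ := by
    have e := orth _ hdz
    have r1 := norm_residual_sq (K := K) henergy (hXK _ hdz)
    have r2 := norm_residual_sq_top henergy (u - w)
    set z := ud - w
    have hs : u - ud = (u - w) - z := by simp [z]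
    have a1 : inner ℝ (K.starProjection (D z + c z)) (D z + c z)
        = ‖K.starProjection (D z + c z)‖ ^ 2 := by
      rw [← real_inner_self_eq_norm_sq, ← Submodule.inner_starProjection_left_eq_right,
        Submodule.starProjection_eq_self_iff.2 (K.starProjection_apply_mem _)]
    rw [hs, map_sub D, map_sub c, map_sub γ₀, sub_add_sub_comm, map_sub, inner_sub_left,
      inner_sub_left, a1, Submodule.inner_starProjection_left_eq_right,
      real_inner_self_eq_norm_sq] at e
    have b1 := real_inner_le_norm (D (u - w) + c (u - w)) (K.starProjection (D z + c z))
    have b2 := real_inner_le_norm (γ₀ (u - w)) (γ₀ z)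
    refine le_of_sq_le_sq ?_ (norm_nonneg _)
    rw [← r1, ← r2]
    nlinarith [sq_nonneg (‖D (u - w) + c (u - w)‖ - ‖K.starProjection (D z + c z)‖),
      sq_nonneg (‖γ₀ (u - w)‖ - ‖γ₀ z‖)]
  calc ‖N (u - ud)‖ = ‖N (u - w) - N (ud - w)‖ := by rw [← map_sub]; congr 2; abel
    _ ≤ ‖N (u - w)‖ + ‖N (ud - w)‖ := norm_sub_le _ _
    _ ≤ 2 * ‖N' (u - w)‖ := by
      have := norm_graphMap_le c D γ K (u - w)
      linarith

end Galerkin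

/-! ### Riesz representation, and dual norms as norms in the energy space. -/

section EnergySpace

variable {X Y Z : Type*} [NormedAddCommGroup X] [NormedSpace ℝ X]
  [NormedAddCommGroup Y] [NormedSpace ℝ Y]
  [NormedAddCommGroup Z] [InnerProductSpace ℝ Z]

theorem exists_riesz [CompleteSpace Z] (e : Y ≃L[ℝ] Z) (L : X →L[ℝ] Y →L[ℝ] ℝ) :
    ∃ D : X →L[ℝ] Z, ∀ u v, inner ℝ (D u) (e v) = L u v := by
  let S := (e.symm : Z →L[ℝ] Y)
  refine ⟨LinearMap.mkContinuous
    { toFun := fun u => (InnerProductSpace.toDual ℝ Z).symm ((L u).comp S)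
      map_add' := fun u v => by simp [ContinuousLinearMap.add_comp]
      map_smul' := fun r u => by simp [ContinuousLinearMap.smul_comp] } (‖L‖ * ‖S‖) (fun u => ?_),
    fun u v => ?_⟩
  · change ‖(InnerProductSpace.toDual ℝ Z).symm ((L u).comp S)‖ ≤ _
    rw [LinearIsometryEquiv.norm_map, mul_right_comm]
    exact ((L u).opNorm_comp_le S).trans
      (mul_le_mul_of_nonneg_right (L.le_opNorm u) (norm_nonneg _))
  · change inner ℝ ((InnerProductSpace.toDual ℝ Z).symm ((L u).comp S)) (e v) = _
    rw [InnerProductSpace.toDual_symm_apply]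
    simp [S]

/-- Only the projection of `z` is seen by `Yd`, and the supremum is attained at its preimage under
`e`. -/
theorem iSup_inner_sq_div (e : Y ≃L[ℝ] Z) (Yd : Submodule ℝ Y)
    (K : Submodule ℝ Z) [K.HasOrthogonalProjection] (hK : ∀ z, z ∈ K ↔ ∃ v ∈ Yd, e v = z) (z : Z) :
    (⨆ v : {v : Y // v ∈ Yd ∧ v ≠ 0}, inner ℝ z (e v) ^ 2 / ‖e v‖ ^ 2)
      = ‖K.starProjection z‖ ^ 2 := by
  have hP : ∀ v ∈ Yd, inner ℝ z (e v) = inner ℝ (K.starProjection z) (e v) := fun v hv => by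
    rw [Submodule.inner_starProjection_left_eq_right,
      Submodule.starProjection_eq_self_iff.2 ((hK _).2 ⟨v, hv, rfl⟩)]
  have hle : ∀ v : {v : Y // v ∈ Yd ∧ v ≠ 0},
      inner ℝ z (e v) ^ 2 / ‖e v‖ ^ 2 ≤ ‖K.starProjection z‖ ^ 2 := fun v => by
    rw [hP v v.2.1]
    refine div_le_of_le_mul₀ (sq_nonneg _) (sq_nonneg _) ?_
    rw [← mul_pow]
    exact sq_le_sq' (by linarith [neg_abs_le (inner ℝ (K.starProjection z) (e v)),
      abs_real_inner_le_norm (K.starProjection z) (e v)]) (real_inner_le_norm _ _)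
  refine le_antisymm (Real.iSup_le hle (sq_nonneg _)) ?_
  obtain ⟨v, hv, hvz⟩ := (hK _).1 (K.starProjection_apply_mem z)
  -- The zero case includes `Yd = 0`, where the supremum over the empty set is 0.
  by_cases h0 : K.starProjection z = 0
  · rw [h0, norm_zero, zero_pow two_ne_zero]
    exact Real.iSup_nonneg fun v => by positivity
  · have hv0 : v ≠ 0 := fun h => h0 (by rw [← hvz, h, map_zero])
    refine le_trans (le_of_eq ?_) (le_ciSup ⟨_, forall_mem_range.2 hle⟩ ⟨v, hv, hv0⟩)
    have hn : 0 < ‖K.starProjection z‖ := norm_pos_iff.2 h0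
    change _ = inner ℝ z (e v) ^ 2 / ‖e v‖ ^ 2
    rw [hP v hv, hvz, real_inner_self_eq_norm_sq]
    field_simp

theorem iSup_abs_inner_div (e : Y ≃L[ℝ] Z) (z : Z) :
    (⨆ v : {v : Y // v ≠ 0}, |inner ℝ z (e v)| / ‖e v‖) = ‖z‖ := by
  have hle : ∀ v : {v : Y // v ≠ 0}, |inner ℝ z (e v)| / ‖e v‖ ≤ ‖z‖ := fun v =>
    div_le_of_le_mul₀ (norm_nonneg _) (norm_nonneg _) (abs_real_inner_le_norm _ _)
  refine le_antisymm (Real.iSup_le hle (norm_nonneg _)) ?_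
  by_cases h0 : z = 0
  · rw [h0, norm_zero]
    exact Real.iSup_nonneg fun v => by positivity
  · have hv0 : e.symm z ≠ 0 := fun h => h0 (by simpa using congrArg e h)
    refine le_trans (le_of_eq ?_) (le_ciSup ⟨_, forall_mem_range.2 hle⟩ ⟨e.symm z, hv0⟩)
    have hn : 0 < ‖z‖ := norm_pos_iff.2 h0
    simp only [e.apply_symm_apply, real_inner_self_eq_norm_sq]
    rw [abs_of_nonneg (sq_nonneg _)]
    field_simp

end EnergySpace

/-- The norm of `X` is controlled by the energy norms of `u` and of the representative of its
time derivative. -/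
theorem norm_spaceX_le {V H Z : Type*} [NormedAddCommGroup V] [InnerProductSpace ℝ V]
    [CompleteSpace V] [NormedAddCommGroup H] [InnerProductSpace ℝ H]
    [NormedAddCommGroup Z] [InnerProductSpace ℝ Z] {j : V →L[ℝ] H} {T : ℝ}
    (e : SpaceY V T ≃L[ℝ] Z) (w : SpaceX j T) {z : Z}
    (hz : ∀ v, inner ℝ z (e v) = pairing V T w.1.2 v) {N : ℝ} (hw : ‖e w.1.1‖ ≤ N)
    (hzN : ‖z‖ ≤ N) :
    ‖w‖ ≤ (‖(e.symm : Z →L[ℝ] SpaceY V T)‖ + ‖(e : SpaceY V T →L[ℝ] Z)‖) * N := by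
  set C₁ := ‖(e.symm : Z →L[ℝ] SpaceY V T)‖
  set C₂ := ‖(e : SpaceY V T →L[ℝ] Z)‖
  have hC₁ : 0 ≤ C₁ := norm_nonneg (e.symm : Z →L[ℝ] SpaceY V T)
  have hC₂ : 0 ≤ C₂ := norm_nonneg (e : SpaceY V T →L[ℝ] Z)
  have hN : 0 ≤ N := (norm_nonneg _).trans hzN
  refine max_le ?_ ?_
  · have h1 := (e.symm : Z →L[ℝ] SpaceY V T).le_opNorm (e w.1.1)
    have h2 : (e.symm : Z →L[ℝ] SpaceY V T) (e w.1.1) = w.1.1 := e.symm_apply_apply _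
    rw [h2] at h1
    exact h1.trans (mul_le_mul (le_add_of_nonneg_right hC₂) hw (norm_nonneg _) (by positivity))
  · change ‖w.1.2‖ ≤ _
    obtain ⟨v, hv1, hv2⟩ := exists_pairing_eq_norm_sq w.1.2
    have h3 : ‖e v‖ ≤ C₂ * ‖w.1.2‖ := hv1 ▸ (e : SpaceY V T →L[ℝ] Z).le_opNorm v
    have h4 : ‖w.1.2‖ * ‖w.1.2‖ ≤ ((C₁ + C₂) * N) * ‖w.1.2‖ := by
      calc ‖w.1.2‖ * ‖w.1.2‖ = inner ℝ z (e v) := by rw [hz, hv2, sq]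
        _ ≤ ‖z‖ * ‖e v‖ := real_inner_le_norm _ _
        _ ≤ N * (C₂ * ‖w.1.2‖) := mul_le_mul hzN h3 (norm_nonneg _) hN
        _ ≤ N * ((C₁ + C₂) * ‖w.1.2‖) := by gcongr; linarith
        _ = ((C₁ + C₂) * N) * ‖w.1.2‖ := by ring
    -- Dividing `h4` by `‖w.1.2‖` requires the zero case to be separate.
    rcases (norm_nonneg w.1.2).eq_or_lt with h0 | h0
    · rw [← h0]; positivity
    · exact le_of_mul_le_mul_right h4 h0

/-- A continuous linear map that is bounded below on a complete subspace maps it to a closed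
subspace. -/
theorem isClosed_map_of_bound {X W : Type*} [NormedAddCommGroup X] [NormedSpace ℝ X]
    [NormedAddCommGroup W] [NormedSpace ℝ W] {Xd : Submodule ℝ X} [CompleteSpace Xd]
    {L : X →ₗ[ℝ] W} (hL : Continuous L) {C : ℝ} (hC : 0 ≤ C) (h : ∀ x ∈ Xd, ‖x‖ ≤ C * ‖L x‖) :
    IsClosed (Xd.map L : Set W) := by
  let f : Xd →L[ℝ] W := ⟨L.comp Xd.subtype, hL.comp continuous_subtype_val⟩
  have hf : AntilipschitzWith (Real.toNNReal C) f :=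
    AddMonoidHomClass.antilipschitz_of_bound f fun x => by
      rw [Real.coe_toNNReal _ hC]
      exact h x x.2
  have hr : (Xd.map L : Set W) = range f := by
    ext z
    simp [f, mem_range]
  rw [hr]
  exact hf.isClosed_range f.uniformContinuous

end SpaceTime

/-! ### Transfer to the energy space and conclusion. -/

theorem theorem3p5
    {V H : Type*}
    [NormedAddCommGroup V] [InnerProductSpace ℝ V] [CompleteSpace V]
    [TopologicalSpace.SeparableSpace V]
    [NormedAddCommGroup H] [InnerProductSpace ℝ H] [CompleteSpace H]
    [TopologicalSpace.SeparableSpace H]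
    -- the dense and compact embedding of `V` into `H`
    (j : V →L[ℝ] H) (hj_inj : Function.Injective j) (hj_dense : DenseRange j)
    (hj_compact : IsCompactOperator j)
    (T : ℝ) (hT : 0 < T)
    -- the bilinear forms: measurable in time, uniformly bounded and coercive
    (a : ℝ → V →ₗ[ℝ] V →ₗ[ℝ] ℝ)
    (ha_meas : ∀ η ζ : V, AEMeasurable (fun t => a t η ζ) (SpaceTime.timeMeasure T))
    (ha_bdd : ∃ M : ℝ, ∀ᵐ t ∂(SpaceTime.timeMeasure T), ∀ η ζ : V,
      |a t η ζ| ≤ M * ‖η‖ * ‖ζ‖)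
    (ha_coer : ∃ α : ℝ, 0 < α ∧ ∀ᵐ t ∂(SpaceTime.timeMeasure T), ∀ η : V,
      α * ‖η‖ ^ 2 ≤ a t η η)
    -- symmetry `A = A_s`
    (hA : ∀ u v : SpaceTime.SpaceY V T, SpaceTime.opA a T u v = SpaceTime.opAs a T u v)
    -- the closed subspaces
    (Yd : Submodule ℝ (SpaceTime.SpaceY V T)) (hYd : IsClosed (Yd : Set (SpaceTime.SpaceY V T)))
    (Hd : Submodule ℝ H) (hHd : IsClosed (Hd : Set H))
    (Xd : Submodule ℝ (SpaceTime.SpaceX j T)) (hXd : IsClosed (Xd : Set (SpaceTime.SpaceX j T)))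
    (hXY : ∀ u ∈ Xd, u.1.1 ∈ Yd)
    (hXH : ∀ u ∈ Xd, SpaceTime.trace j T 0 u ∈ Hd)
    (g : StrongDual ℝ (SpaceTime.SpaceY V T)) (u₀ : H) :
    -- unique solvability
    ((FiniteDimensional ℝ Xd ∨
        ∃ κ : ℝ, 0 < κ ∧ ∀ w ∈ Xd, κ * SpaceTime.normX j a T w ≤ SpaceTime.normXY j a T Yd w) →
      ∃! p : Yd × Hd × Xd, SpaceTime.IsGalerkinSolution j a T Yd Hd Xd g u₀ p) ∧
    -- uniqueness, for all closed subspaces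
    (∀ p q : Yd × Hd × Xd, SpaceTime.IsGalerkinSolution j a T Yd Hd Xd g u₀ p →
      SpaceTime.IsGalerkinSolution j a T Yd Hd Xd g u₀ q → p = q) ∧
    -- the error estimate, for all closed subspaces
    (∀ (p : Yd × Hd × Xd) (u : SpaceTime.SpaceX j T),
      SpaceTime.IsGalerkinSolution j a T Yd Hd Xd g u₀ p →
      SpaceTime.IsExactSolution j a T g u₀ u →
      SpaceTime.normXY j a T Yd (u - (p.2.2 : SpaceTime.SpaceX j T))
        ≤ 2 * ⨅ w : Xd, SpaceTime.normX j a T (u - (w : SpaceTime.SpaceX j T))) := by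
  obtain ⟨M, hM⟩ := ha_bdd
  obtain ⟨α, hα, hcoer⟩ := ha_coer
  have hsymm : ∀ u v : SpaceTime.SpaceY V T, SpaceTime.opA a T u v = SpaceTime.opA a T v u := by
    intro u v
    have h := hA u v
    rw [SpaceTime.opAs] at h
    linarith
  obtain ⟨Z, _, _, _, e, he⟩ := SpaceTime.exists_energySpace (SpaceTime.opA a T) hsymm
    (SpaceTime.opA_add_left ha_meas hM) SpaceTime.opA_smul_left hα
    (SpaceTime.opA_self_le ha_meas hM) (SpaceTime.le_opA_self ha_meas hM hcoer)
  let πu : SpaceTime.SpaceX j T →L[ℝ] SpaceTime.SpaceY V T :=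
    (ContinuousLinearMap.fst ℝ _ _).comp (SpaceTime.SpaceX j T).subtypeL
  let πw : SpaceTime.SpaceX j T →L[ℝ] SpaceTime.SpaceL2Dual V T :=
    (ContinuousLinearMap.snd ℝ _ _).comp (SpaceTime.SpaceX j T).subtypeL
  obtain ⟨D, hD⟩ := SpaceTime.exists_riesz e ((SpaceTime.pairing V T).comp πw)
  let c : SpaceTime.SpaceX j T →L[ℝ] Z := (e : SpaceTime.SpaceY V T →L[ℝ] Z).comp πu
  let γ₀ := SpaceTime.traceCLM hj_inj hj_dense hj_compact hT (t := 0) ⟨le_rfl, hT.le⟩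
  let γ := SpaceTime.traceCLM hj_inj hj_dense hj_compact hT (t := T) ⟨hT.le, le_rfl⟩
  let cₗ : SpaceTime.SpaceX j T →ₗ[ℝ] Z := c
  let Dₗ : SpaceTime.SpaceX j T →ₗ[ℝ] Z := D
  let γ₀ₗ : SpaceTime.SpaceX j T →ₗ[ℝ] H := γ₀
  let γₗ : SpaceTime.SpaceX j T →ₗ[ℝ] H := γ
  let gz : Z := (InnerProductSpace.toDual ℝ Z).symm
    (g.comp (e.symm : Z →L[ℝ] SpaceTime.SpaceY V T))
  have hgz : ∀ v, inner ℝ gz (e v) = g v := fun v => by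
    simp only [gz, InnerProductSpace.toDual_symm_apply]
    simp
  have hDt : ∀ u v, SpaceTime.opDt j T u v = inner ℝ (D u) (e v) := fun u v => by
    rw [hD]
    exact (SpaceTime.pairing_apply _ _).symm
  have hAs : ∀ u v, SpaceTime.opAs a T u v = inner ℝ (e u) (e v) := fun u v => by rw [he, hA]
  have hB : ∀ u v, SpaceTime.opB j a T u v = inner ℝ (D u + c u) (e v) := fun u v => by
    rw [inner_add_left, ← hDt]
    change _ = _ + inner ℝ (e u.1.1) (e v)
    rw [he]
    exact integral_add (SpaceTime.integrable_pairing u.1.2 v)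
      (SpaceTime.integrable_form ha_meas hM u.1.1 v)
  have hnY : ∀ v, SpaceTime.normY a T v = ‖e v‖ := fun v => by
    rw [SpaceTime.normY, hAs, real_inner_self_eq_norm_sq, Real.sqrt_sq (norm_nonneg _)]
  have henergy : ∀ u, 2 * inner ℝ (Dₗ u) (cₗ u) = ‖γₗ u‖ ^ 2 - ‖γ₀ₗ u‖ ^ 2 := fun u => by
    have h := SpaceTime.two_mul_opDt_self hj_inj hj_dense hj_compact hT u
    rw [hDt] at h
    exact h
  -- The image of `Yδ`; it is closed, so the projection onto it exists.
  let K : Submodule ℝ Z := Yd.map (e : SpaceTime.SpaceY V T →ₗ[ℝ] Z)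
  have hK : IsClosed (K : Set Z) := by
    have : (K : Set Z) = e '' Yd := rfl
    rw [this]
    exact e.toHomeomorph.isClosedMap _ hYd
  have : CompleteSpace K := hK.completeSpace_coe
  have : CompleteSpace Hd := hHd.completeSpace_coe
  have hnX : ∀ u, SpaceTime.normX j a T u
      = ‖SpaceTime.graphMap cₗ Dₗ γₗ (ContinuousLinearMap.id ℝ Z) u‖ := fun u => by
    rw [← Real.sqrt_sq (norm_nonneg (SpaceTime.graphMap _ _ _ _ u)),
      SpaceTime.norm_graphMap_sq, SpaceTime.normX, SpaceTime.normYDual, hnY]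
    simp only [hDt, hnY, SpaceTime.iSup_abs_inner_div]
    rfl
  have hnXY : ∀ u, SpaceTime.normXY j a T Yd u
      = ‖SpaceTime.graphMap cₗ Dₗ γₗ K.starProjection u‖ := fun u => by
    rw [← Real.sqrt_sq (norm_nonneg (SpaceTime.graphMap _ _ _ _ u)),
      SpaceTime.norm_graphMap_sq, SpaceTime.normXY, hnY]
    simp only [hDt, hnY]
    rw [SpaceTime.iSup_inner_sq_div e Yd K fun z => Submodule.mem_map]
    rfl
  have hXK : ∀ u ∈ Xd, cₗ u ∈ K := fun u hu => Submodule.mem_map_of_mem (hXY u hu)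
  have hXH' : ∀ u ∈ Xd, γ₀ₗ u ∈ Hd := hXH
  have hcinj : Function.Injective cₗ := by
    intro u v h
    exact SpaceTime.spaceX_ext (e.injective (h : e u.1.1 = e v.1.1))
  have hiff : ∀ p : Yd × Hd × Xd, SpaceTime.IsGalerkinSolution j a T Yd Hd Xd g u₀ p ↔
      SpaceTime.IsSaddlePoint cₗ Dₗ γ₀ₗ K Hd Xd gz u₀ (e p.1) p.2.1 p.2.2 := by
    intro p
    refine and_congr ⟨fun h z hz => ?_, fun h v hv => ?_⟩ (and_congr Iff.rfl
      (forall₂_congr fun w hw => ?_))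
    · obtain ⟨v, hv, rfl⟩ := Submodule.mem_map.1 hz
      have h' := h v hv
      rw [hAs, hB, ← hgz] at h'
      exact h'
    · rw [hAs, hB, ← hgz]
      exact h _ (Submodule.mem_map_of_mem hv)
    · rw [hB]
      rfl
  have huniq : ∀ p q : Yd × Hd × Xd, SpaceTime.IsGalerkinSolution j a T Yd Hd Xd g u₀ p →
      SpaceTime.IsGalerkinSolution j a T Yd Hd Xd g u₀ q → p = q := by
    intro p q hp hq
    obtain ⟨h1, h2, h3⟩ := SpaceTime.IsSaddlePoint.unique henergy hcinj hXK hXH'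
      (Submodule.mem_map_of_mem p.1.2) (Submodule.mem_map_of_mem q.1.2) p.2.1.2 q.2.1.2
      p.2.2.2 q.2.2.2 ((hiff p).1 hp) ((hiff q).1 hq)
    exact Prod.ext (Subtype.ext (e.injective h1)) (Prod.ext (Subtype.ext h2) (Subtype.ext h3))
  refine ⟨fun hcase => ?_, huniq, fun p u hp hu => ?_⟩
  · let L := SpaceTime.residualMap cₗ Dₗ γ₀ₗ K.starProjection
    have hcl : IsClosed (Xd.map L : Set (WithLp 2 (Z × H))) := by
      rcases hcase with hfin | ⟨κ, hκ, hκb⟩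
      -- In finite dimension the range is closed without any stability constant.
      · exact Submodule.closed_of_finiteDimensional _
      have hXc : CompleteSpace (SpaceTime.SpaceX j T) :=
        (SpaceTime.isClosed_spaceX j T).completeSpace_coe
      have hXdc : CompleteSpace Xd := hXd.completeSpace_coe
      have hLc : Continuous L :=
        (WithLp.prod_continuous_toLp 2 Z H).comp
          ((K.starProjection.continuous.comp (D.continuous.add c.continuous)).prodMk
            γ₀.continuous)
      let C : ℝ := ‖(e.symm : Z →L[ℝ] SpaceTime.SpaceY V T)‖
        + ‖(e : SpaceTime.SpaceY V T →L[ℝ] Z)‖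
      have hC : 0 ≤ C := add_nonneg (norm_nonneg _) (norm_nonneg _)
      refine SpaceTime.isClosed_map_of_bound hLc (div_nonneg hC hκ.le) fun w hw => ?_
      -- On `Xδ` the norm of `L w` is exactly `‖w‖_{X,Yδ}`, so the `κ` bound makes `L` bounded below
      -- and its range closed.
      have hLn : κ * SpaceTime.normX j a T w ≤ ‖L w‖ := by
        refine (hκb w hw).trans (le_of_eq ?_)
        rw [hnXY, ← sq_eq_sq₀ (norm_nonneg _) (norm_nonneg _),
          ← SpaceTime.norm_residual_sq henergy (hXK w hw), WithLp.prod_norm_sq_eq_of_L2]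
        rfl
      have hsq : SpaceTime.normX j a T w ^ 2 = ‖cₗ w‖ ^ 2 + ‖Dₗ w‖ ^ 2 + ‖γₗ w‖ ^ 2 := by
        rw [hnX, SpaceTime.norm_graphMap_sq, ContinuousLinearMap.id_apply]
      have hN0 : 0 ≤ SpaceTime.normX j a T w := Real.sqrt_nonneg _
      have hc1 : ‖cₗ w‖ ≤ SpaceTime.normX j a T w :=
        le_of_sq_le_sq (by rw [hsq]; linarith [sq_nonneg ‖Dₗ w‖, sq_nonneg ‖γₗ w‖]) hN0
      have hD1 : ‖Dₗ w‖ ≤ SpaceTime.normX j a T w :=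
        le_of_sq_le_sq (by rw [hsq]; linarith [sq_nonneg ‖cₗ w‖, sq_nonneg ‖γₗ w‖]) hN0
      have hX := SpaceTime.norm_spaceX_le e w (hD w) hc1 hD1
      rw [div_mul_eq_mul_div, le_div_iff₀ hκ]
      calc ‖w‖ * κ ≤ C * SpaceTime.normX j a T w * κ := mul_le_mul_of_nonneg_right hX hκ.le
        _ = C * (κ * SpaceTime.normX j a T w) := by ring
        _ ≤ C * ‖L w‖ := mul_le_mul_of_nonneg_left hLn hC
    obtain ⟨μ, hμ, σ, hσ, w, hw, hs⟩ := SpaceTime.exists_isSaddlePoint hXH' hcl gz u₀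
    obtain ⟨v, hv, rfl⟩ := Submodule.mem_map.1 hμ
    have hsol := (hiff (⟨v, hv⟩, ⟨σ, hσ⟩, ⟨w, hw⟩)).2 hs
    exact ⟨_, hsol, fun q hq => huniq _ _ hq hsol⟩
  -- Testing with `(v, 0)` and with `(0, z)` separates the exact equation into `B u = g` and `u(0) =
  -- u₀`.
  · have hBu : D u + c u = gz := by
      refine ext_inner_right ℝ fun z => ?_
      obtain ⟨v, rfl⟩ := e.surjective z
      have h := hu v 0
      rw [inner_zero_right, inner_zero_right, add_zero, add_zero] at h
      rw [← hB, hgz, h]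
    have hu0 : γ₀ u = u₀ := by
      refine ext_inner_right ℝ fun z => ?_
      have h := hu 0 z
      rw [hB, map_zero, inner_zero_right, map_zero, zero_add, zero_add] at h
      exact h
    rw [Real.mul_iInf_of_nonneg zero_le_two]
    refine le_ciInf fun w => ?_
    rw [hnXY, hnX]
    exact SpaceTime.IsSaddlePoint.error_le henergy hXK hXH' (Submodule.mem_map_of_mem p.1.2)
      p.2.2.2 ((hiff p).1 hp) hBu hu0 w.2
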